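/- Let $d\ge 2$ and let $\mathcal T_h$ be a finite face-to-face partition, into nondegenerate closed $d$-simplices, of a polytope $\Omega\subset\mathbb R^d$ (so $\Omega$ is the interior of the union of the elements $K\in\mathcal T_h$). Let $\Gamma_N$ and $\Gamma_D$ be disjoint relatively open portions of $\partial\Omega$ with $\overline{\Gamma}_D\cup\overline{\Gamma}_N=\partial\Omega$, whose closures are unions of boundary facets of $\mathcal T_h$; "$\gamma\subset\Gamma_N\cap\partial K$" ranges over the facets of $K$ that lie in $\overline\Gamma_N$. Let $f\in L^2(\Omega)$, $g_N\in L^2(\Gamma_N)$, and let $\kappa\ge 0$ be constant, equal to $\kappa_K$, in each $K\in\mathcal T_h$. Put $V=\{v\in H^1(\Omega): v=0 \text{ on }\Gamma_D\}$, $$\mathcal B(u,v)=\int_\Omega(\nabla u\cdot\nabla v+\kappa^2uv)\,dx,\qquad \mathcal F(v)=\int_\Omega fv\,dx+\int_{\Gamma_N}g_Nv\,ds,\qquad |||v|||^2=\mathcal B(v,v).$$ Let $u\in V$ satisfy $\mathcal B(u,v)=\mathcal F(v)$ for all $v\in V$, and let $u_h\in V$ be arbitrary (not necessarily a Galerkin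 solution). Let $\Pi_K$ and $\Pi_\gamma$ be the $L^2(K)$- and $L^2(\gamma)$-orthogonal projections onto affine functions, and let $\Pi f$ and $\Pi_N g_N$ be given by $(\Pi f)|_K=\Pi_Kf$ and $(\Pi_Ng_N)|_\gamma=\Pi_\gamma g_N$. Let $\tau\in H(\mathrm{div},\Omega)$ have a normal trace $\tau\cdot\nu\in L^2(\Gamma_N)$, that is, $\int_\Omega(\tau\cdot\nabla v+v\,\mathrm{div}\,\tau)\,dx=\int_{\Gamma_N}(\tau\cdot\nu)\,v\,ds$ for all $v\in V$. Assume that for every $K\in\mathcal T_h$ with $\kappa_K=0$, $$-\mathrm{div}\,\tau=\Pi f-\kappa^2u_h\ \text{ in }K,\qquad \tau\cdot\nu=\Pi_Ng_N\ \text{ on all facets }\gamma\subset\Gamma_N\cap\partial K .$$ Put $\varepsilon=\tau-\nabla u_h$, $r=\Pi f-\kappa^2u_h+\mathrm{div}\,\tau$, $R_N=\Pi_Ng_N-\tau\cdot\nu$, let $h_K=\operatorname{diam}K$, and let $m_K=\min\{h_K/\pi,\kappa_K^{-1}\}$, where $m_K=h_K/\pi$ if $\kappa_K=0$. Define $C_T^{K,\gamma}$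 (for $\kappa_K>0$) and $\overline C_T^{K,\gamma}$ as the nonnegative numbers with $$\left(C_T^{K,\gamma}\right)^2=\frac{|\gamma|}{d|K|}\frac1{\kappa_K}\sqrt{(2h_K)^2+(d/\kappa_K)^2},\qquad \left(\overline C_T^{K,\gamma}\right)^2=\frac{|\gamma|}{d|K|}\,m_K\left(2h_K+d\,m_K\right),$$ and $$\eta_K(\tau)=\left(\|\varepsilon\|_K^2+\kappa_K^{-2}\|r\|_K^2\right)^{1/2}+\sum_{\gamma\subset\Gamma_N\cap\partial K}C_T^{K,\gamma}\|R_N\|_\gamma\ \text{ if }\kappa_K>0,\qquad \eta_K(\tau)=\|\varepsilon\|_K\ \text{ if }\kappa_K=0,$$ $$\mathrm{osc}_K(f,g_N)=m_K\|f-\Pi_Kf\|_K+\sum_{\gamma\subset\Gamma_N\cap\partial K}\min\{C_T^{K,\gamma},\overline C_T^{K,\gamma}\}\,\|g_N-\Pi_\gamma g_N\|_\gamma ,$$ where the last minimum is $\overline C_T^{K,\gamma}$ if $\kappa_K=0$, and $\|\cdot\|_K$, $\|\cdot\|_\gamma$ are the $L^2$ norms. Then $$|||u-u_h|||\le\eta(\tau),\qquad\text{where}\quad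 \eta^2(\tau)=\sum_{K\in\mathcal T_h}\left[\eta_K(\tau)+\mathrm{osc}_K(f,g_N)\right]^2 .$$ -/

import Mathlib

open MeasureTheory Filter Topology TopologicalSpace
open scoped ENNReal ContDiff Distributions

noncomputable section

namespace ReactionDiffusion

/-- The Euclidean space `ℝ^d`. -/
abbrev Euc (d : ℕ) : Type := EuclideanSpace ℝ (Fin d)

/-- The closed simplex (element, facet, ...) with vertex set `s`. -/
def hull {d : ℕ} (s : Finset (Euc d)) : Set (Euc d) := convexHull ℝ (s : Set (Euc d))

/-- The `(d-1)`-dimensional surface measure `ds` on `ℝ^d`: the Hausdorff measure, normalized so that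
it is the Lebesgue measure on hyperplanes. -/
def surf (d : ℕ) : Measure (Euc d) := Measure.euclideanHausdorffMeasure (d - 1)

/-- The norm of `L²(μ)`, for scalar or vector valued square integrable functions. -/
def l2norm {d : ℕ} {F : Type*} [NormedAddCommGroup F] (μ : Measure (Euc d)) (g : Euc d → F) : ℝ :=
  Real.sqrt (∫ x, ‖g x‖ ^ 2 ∂μ)

/-! ### The space of affine functions and the `L²` projection onto it -/

/-- The affine functions which are square integrable for `μ`
(all of them, if `μ` is the volume on an element or the surface measure on a facet). -/
def sqIntegrableAffine {d : ℕ} (μ : Measure (Euc d)) : Submodule ℝ (Euc d →ᵃ[ℝ] ℝ) where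
  carrier := {p | MemLp p 2 μ}
  add_mem' := fun {p q} hp hq => by simpa using MemLp.add hp hq
  zero_mem' := by simp
  smul_mem' := fun c p hp => by simpa using MemLp.const_smul hp c

/-- The class in `L²(μ)` of an affine function. -/
def affineToLp {d : ℕ} (μ : Measure (Euc d)) : sqIntegrableAffine μ →ₗ[ℝ] Lp ℝ 2 μ where
  toFun p := MemLp.toLp p.1 p.2
  map_add' p q := MemLp.toLp_add p.2 q.2
  map_smul' c p := MemLp.toLp_const_smul c p.2

/-- The subspace of `L²(μ)` of (classes of) affine functions. -/
def affineSubspaceL2 {d : ℕ} (μ : Measure (Euc d)) : Submodule ℝ (Lp ℝ 2 μ) :=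
  LinearMap.range (affineToLp μ)

instance finiteDimensional_affine (d : ℕ) : FiniteDimensional ℝ (Euc d →ᵃ[ℝ] ℝ) :=
  LinearEquiv.finiteDimensional
    (AffineMap.toConstProdLinearMap ℝ : (Euc d →ᵃ[ℝ] ℝ) ≃ₗ[ℝ] _).symm

instance finiteDimensional_affineSubspaceL2 {d : ℕ} (μ : Measure (Euc d)) :
    FiniteDimensional ℝ (affineSubspaceL2 μ) := by
  unfold affineSubspaceL2; infer_instance

open Classical in
/-- The `L²(μ)`-orthogonal projection of `g ∈ L²(μ)` onto the affine functions. -/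
def affineProj {d : ℕ} (μ : Measure (Euc d)) (g : Euc d → ℝ) : Euc d → ℝ :=
  if h : MemLp g 2 μ then (affineSubspaceL2 μ).starProjection (h.toLp g) else 0

/-! ### Meshes -/

/-- A conforming partition into finitely many nondegenerate `d`-simplices. An element is given by
its set of vertices; two elements meet in their common (possibly empty) face. -/
structure Mesh (d : ℕ) where
  elements : Finset (Finset (Euc d))
  card_eq : ∀ K ∈ elements, K.card = d + 1
  affineIndependent : ∀ K ∈ elements, AffineIndependent ℝ ((↑) : K → Euc d)
  conforming : ∀ K ∈ elements, ∀ L ∈ elements,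
    hull K ∩ hull L = convexHull ℝ ((K : Set (Euc d)) ∩ (L : Set (Euc d)))

/-- The open polytope `Ω` covered by the mesh. -/
def Mesh.domain {d : ℕ} (T : Mesh d) : Opens (Euc d) :=
  ⟨interior (⋃ K ∈ T.elements, hull K), isOpen_interior⟩

/-- A boundary facet: a facet of exactly one element. The union of these facets is `∂Ω`. -/
def Mesh.IsBoundaryFacet {d : ℕ} (T : Mesh d) (γ : Finset (Euc d)) : Prop :=
  γ.card = d ∧ ∃! K, K ∈ T.elements ∧ γ ⊆ K

/-- The boundary `∂Ω`. -/
def Mesh.bdry {d : ℕ} (T : Mesh d) : Set (Euc d) :=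
  ⋃ γ ∈ {γ | T.IsBoundaryFacet γ}, hull γ

/-- The volume measure on an open set `Ω`. -/
def vol {d : ℕ} (Ω : Opens (Euc d)) : Measure (Euc d) := volume.restrict (Ω : Set (Euc d))

/-! ### Function spaces -/

/-- The Sobolev space `H¹(Ω)`: a square integrable function with a square integrable
weak gradient. -/
structure H1 {d : ℕ} (Ω : Opens (Euc d)) where
  val : Euc d → ℝ
  grad : Euc d → Euc d
  memLp_val : MemLp val 2 (vol Ω)
  memLp_grad : MemLp grad 2 (vol Ω)
  weak : ∀ φ : 𝓓(Ω, ℝ), ∫ x, val x • gradient φ x ∂(vol Ω) = - ∫ x, φ x • grad x ∂(vol Ω)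

/-- The space `H(div, Ω)`: a square integrable field with a square integrable weak divergence. -/
structure Hdiv {d : ℕ} (Ω : Opens (Euc d)) where
  val : Euc d → Euc d
  div : Euc d → ℝ
  memLp_val : MemLp val 2 (vol Ω)
  memLp_div : MemLp div 2 (vol Ω)
  weak : ∀ φ : 𝓓(Ω, ℝ),
    ∫ x, inner ℝ (val x) (gradient φ x) ∂(vol Ω) = - ∫ x, div x * φ x ∂(vol Ω)

/-- `t` is the trace on `∂Ω` of `v ∈ H¹(Ω)`: the trace operator is the extension by continuity, from
`H¹(Ω)` to `L²(∂Ω)`, of the restriction to `∂Ω` of functions which are smooth up to the boundary. -/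
def IsTrace {d : ℕ} (T : Mesh d) (v : H1 T.domain) (t : Euc d → ℝ) : Prop :=
  MemLp t 2 ((surf d).restrict T.bdry) ∧
  ∃ φ : ℕ → Euc d → ℝ, (∀ n, ContDiff ℝ ∞ (φ n)) ∧
    Tendsto (fun n => eLpNorm (φ n - v.val) 2 (vol T.domain)) atTop (𝓝 0) ∧
    Tendsto (fun n => eLpNorm (gradient (φ n) - v.grad) 2 (vol T.domain)) atTop (𝓝 0) ∧
    Tendsto (fun n => eLpNorm (φ n - t) 2 ((surf d).restrict T.bdry)) atTop (𝓝 0)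

/-! ### The model problem -/

/-- The data of the problem `-Δu + κ²u = f` in `Ω`, `u = 0` on `Γ_D`, `∂u/∂ν = g_N` on `Γ_N`,
together with a mesh of `Ω` which is compatible with `κ` and with the splitting of `∂Ω`. -/
structure Problem (d : ℕ) where
  mesh : Mesh d
  /-- The boundary facets that make up (the closure of) `Γ_N`; the others make up `Γ_D`. -/
  neumann : Finset (Finset (Euc d))
  neumann_bdry : ∀ γ ∈ neumann, mesh.IsBoundaryFacet γ
  /-- The reaction coefficient `κ`. -/
  kappa : Euc d → ℝ
  /-- The constant value `κ_K` of `κ` in the element `K`. -/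
  kappaK : Finset (Euc d) → ℝ
  kappaK_nonneg : ∀ K ∈ mesh.elements, 0 ≤ kappaK K
  kappa_eq : ∀ K ∈ mesh.elements, ∀ x ∈ interior (hull K), kappa x = kappaK K
  f : Euc d → ℝ
  memLp_f : MemLp f 2 (vol mesh.domain)
  gN : Euc d → ℝ
  memLp_gN : MemLp gN 2 ((surf d).restrict (⋃ γ ∈ neumann, hull γ))

namespace Problem

variable {d : ℕ} (P : Problem d)

/-- The domain `Ω`. -/
abbrev Ω : Opens (Euc d) := P.mesh.domain

/-- The Neumann boundary `Γ_N` (up to a set of surface measure zero). -/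
def ΓN : Set (Euc d) := ⋃ γ ∈ P.neumann, hull γ

/-- The Dirichlet boundary `Γ_D` (up to a set of surface measure zero). -/
def ΓD : Set (Euc d) := ⋃ γ ∈ {γ | P.mesh.IsBoundaryFacet γ ∧ γ ∉ P.neumann}, hull γ

/-- The space `V` of functions in `H¹(Ω)` whose trace vanishes on `Γ_D`.
An element carries its trace, which is unique up to a set of surface measure zero. -/
structure V extends H1 P.mesh.domain where
  trace : Euc d → ℝ
  isTrace : IsTrace P.mesh toH1 trace
  vanish : trace =ᵐ[(surf d).restrict P.ΓD] 0

/-- The bilinear form `ℬ(u, v) = ∫_Ω (∇u·∇v + κ² u v) dx`. -/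
def bilin (u v : P.V) : ℝ :=
  ∫ x, (inner ℝ (u.grad x) (v.grad x) + P.kappa x ^ 2 * u.val x * v.val x) ∂(vol P.Ω)

/-- The linear form `ℱ(v) = ∫_Ω f v dx + ∫_{Γ_N} g_N v ds`. -/
def lin (v : P.V) : ℝ :=
  (∫ x, P.f x * v.val x ∂(vol P.Ω)) + ∫ x, P.gN x * v.trace x ∂((surf d).restrict P.ΓN)

/-- The weak formulation `ℬ(u, v) = ℱ(v)` for all `v ∈ V`. -/
def IsWeakSolution (u : P.V) : Prop := ∀ v : P.V, P.bilin u v = P.lin v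

/-- The energy norm `|||v||| = ℬ(v, v)^{1/2}`. -/
def energyNorm (v : P.V) : ℝ := Real.sqrt (P.bilin v v)

/-- `g` is the normal trace `τ·ν` of `τ ∈ H(div, Ω)` on `Γ_N`, and it is in `L²(Γ_N)`. -/
def IsNormalTrace (τ : Hdiv P.mesh.domain) (g : Euc d → ℝ) : Prop :=
  MemLp g 2 ((surf d).restrict P.ΓN) ∧
  ∀ v : P.V, ∫ x, (inner ℝ (τ.val x) (v.grad x) + τ.div x * v.val x) ∂(vol P.Ω) =
    ∫ x, g x * v.trace x ∂((surf d).restrict P.ΓN)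

/-! ### Projected data and residuals -/

/-- `Π_K f`. -/
def projf (K : Finset (Euc d)) : Euc d → ℝ := affineProj (volume.restrict (hull K)) P.f

/-- `Π_γ g_N`. -/
def projg (γ : Finset (Euc d)) : Euc d → ℝ := affineProj ((surf d).restrict (hull γ)) P.gN

variable (uh : P.V) (τ : Hdiv P.mesh.domain) (τν : Euc d → ℝ)

/-- `ε = τ - ∇u_h`. -/
def eps (x : Euc d) : Euc d := τ.val x - uh.grad x

/-- `r = Π f - κ² u_h + div τ` on the element `K`. -/
def residual (K : Finset (Euc d)) (x : Euc d) : ℝ :=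
  P.projf K x - P.kappa x ^ 2 * uh.val x + τ.div x

/-- `R_N = Π_N g_N - τ·ν` on the Neumann facet `γ`. -/
def residualN (γ : Finset (Euc d)) (x : Euc d) : ℝ := P.projg γ x - τν x

/-- The equilibration conditions: `-div τ = Π f - κ² u_h` in all elements `K` with `κ_K = 0`, and
`τ·ν = Π_N g_N` on all facets `γ ⊂ Γ_N ∩ ∂K` of such elements. -/
def Equilibrated : Prop :=
  ∀ K ∈ P.mesh.elements, P.kappaK K = 0 →
    (∀ᵐ x ∂(volume.restrict (hull K)),
      - τ.div x = P.projf K x - P.kappa x ^ 2 * uh.val x) ∧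
    ∀ γ ∈ P.neumann, γ ⊆ K → ∀ᵐ x ∂((surf d).restrict (hull γ)), τν x = P.projg γ x

/-! ### The estimator -/

/-- The diameter `h_K`. -/
def h (K : Finset (Euc d)) : ℝ := Metric.diam (hull K)

/-- `|γ| / (d |K|)`. -/
def ratio (K γ : Finset (Euc d)) : ℝ := (surf d).real (hull γ) / (d * volume.real (hull K))

open Classical in
/-- `min {h_K/π, 1/κ_K}`, which is `h_K/π` if `κ_K = 0`. -/
def minh (K : Finset (Euc d)) : ℝ :=
  if P.kappaK K = 0 then h K / Real.pi else min (h K / Real.pi) (1 / P.kappaK K)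

/-- `C_T^{K,γ}`, used only if `κ_K > 0` (it is infinite if `κ_K = 0`). -/
def CT (K γ : Finset (Euc d)) : ℝ :=
  Real.sqrt (ratio K γ * (1 / P.kappaK K) *
    Real.sqrt ((2 * h K) ^ 2 + (d / P.kappaK K) ^ 2))

/-- `\overline{C}_T^{K,γ}`. -/
def CTbar (K γ : Finset (Euc d)) : ℝ :=
  Real.sqrt (ratio K γ * P.minh K * (2 * h K + d * P.minh K))

open Classical in
/-- `min {C_T, \overline{C}_T}`, which is `\overline{C}_T` if `κ_K = 0`. -/
def minCT (K γ : Finset (Euc d)) : ℝ :=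
  if P.kappaK K = 0 then P.CTbar K γ else min (P.CT K γ) (P.CTbar K γ)

open Classical in
/-- The Neumann facets of `K`, that is, the facets `γ ⊂ Γ_N ∩ ∂K`. -/
def neumannOf (K : Finset (Euc d)) : Finset (Finset (Euc d)) := {γ ∈ P.neumann | γ ⊆ K}

open Classical in
/-- The local error indicator `η_K(τ)`; the terms with `r` and `R_N` are zero if `κ_K = 0`. -/
def etaK (K : Finset (Euc d)) : ℝ :=
  if P.kappaK K = 0 then l2norm (volume.restrict (hull K)) (P.eps uh τ)
  else
    Real.sqrt (l2norm (volume.restrict (hull K)) (P.eps uh τ) ^ 2 +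
      (P.kappaK K)⁻¹ ^ 2 * l2norm (volume.restrict (hull K)) (P.residual uh τ K) ^ 2) +
    ∑ γ ∈ P.neumannOf K,
      P.CT K γ * l2norm ((surf d).restrict (hull γ)) (P.residualN τν γ)

/-- The oscillation term `osc_K(f, g_N)`. -/
def osc (K : Finset (Euc d)) : ℝ :=
  P.minh K * l2norm (volume.restrict (hull K)) (fun x => P.f x - P.projf K x) +
  ∑ γ ∈ P.neumannOf K,
    P.minCT K γ * l2norm ((surf d).restrict (hull γ)) (fun x => P.gN x - P.projg γ x)

/-- The error estimator `η(τ)`. -/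
def eta : ℝ := Real.sqrt (∑ K ∈ P.mesh.elements, (P.etaK uh τ τν K + P.osc K) ^ 2)

end Problem

/-! ### Differences of elements of `V` -/

lemma continuous_gradient {d : ℕ} {φ : Euc d → ℝ} (hφ : ContDiff ℝ ∞ φ) :
    Continuous (gradient φ) :=
  (InnerProductSpace.toDual ℝ (Euc d)).symm.continuous.comp (hφ.continuous_fderiv (by simp))

lemma gradient_sub' {d : ℕ} {φ ψ : Euc d → ℝ} (hφ : ContDiff ℝ ∞ φ) (hψ : ContDiff ℝ ∞ ψ) :
    gradient (φ - ψ) = gradient φ - gradient ψ := by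
  ext1 x
  have h1 : DifferentiableAt ℝ φ x := (hφ.differentiable (by simp)) x
  have h2 : DifferentiableAt ℝ ψ x := (hψ.differentiable (by simp)) x
  simp [gradient, fderiv_sub h1 h2]

lemma integrable_smul_test {d : ℕ} {F : Type*} [NormedAddCommGroup F] [NormedSpace ℝ F]
    {μ : Measure (Euc d)} [IsFiniteMeasureOnCompacts μ] {v : Euc d → ℝ} {g : Euc d → F}
    [SecondCountableTopologyEither (Euc d) F]
    (hv : MemLp v 2 μ) (hg : Continuous g) (hc : HasCompactSupport g) :
    Integrable (fun x => v x • g x) μ := by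
  have h2 : MemLp g 2 μ := hg.memLp_of_hasCompactSupport hc
  exact memLp_one_iff_integrable.1 (h2.smul (r := 1) hv)

lemma integrable_test_smul {d : ℕ} {F : Type*} [NormedAddCommGroup F] [NormedSpace ℝ F]
    {μ : Measure (Euc d)} [IsFiniteMeasureOnCompacts μ] {φ : Euc d → ℝ} {g : Euc d → F}
    (hg : MemLp g 2 μ) (hφ : Continuous φ) (hc : HasCompactSupport φ) :
    Integrable (fun x => φ x • g x) μ := by
  have h2 : MemLp φ 2 μ := hφ.memLp_of_hasCompactSupport hc
  exact memLp_one_iff_integrable.1 (hg.smul (r := 1) h2)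

lemma hasCompactSupport_gradient {d : ℕ} {φ : Euc d → ℝ} (hc : HasCompactSupport φ) :
    HasCompactSupport (gradient φ) :=
  (hc.fderiv ℝ).comp_left (g := (InnerProductSpace.toDual ℝ (Euc d)).symm) (map_zero _)

instance {d : ℕ} (Ω : Opens (Euc d)) : IsFiniteMeasureOnCompacts (vol Ω) := by
  unfold vol; infer_instance

instance {d : ℕ} (Ω : Opens (Euc d)) : Sub (H1 Ω) where
  sub u v :=
    { val := u.val - v.val
      grad := u.grad - v.grad
      memLp_val := u.memLp_val.sub v.memLp_val
      memLp_grad := u.memLp_grad.sub v.memLp_grad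
      weak := fun φ => by
        have c1 : ContDiff ℝ ∞ φ := φ.contDiff
        have c2 : HasCompactSupport φ := φ.hasCompactSupport
        have g1 := continuous_gradient c1
        have g2 := hasCompactSupport_gradient c2
        simp only [Pi.sub_apply, sub_smul, smul_sub]
        rw [integral_sub (integrable_smul_test u.memLp_val g1 g2)
            (integrable_smul_test v.memLp_val g1 g2),
          integral_sub (integrable_test_smul u.memLp_grad c1.continuous c2)
            (integrable_test_smul v.memLp_grad c1.continuous c2), u.weak, v.weak]
        abel }

lemma tendsto_eLpNorm_sub {d : ℕ} {F : Type*} [NormedAddCommGroup F] {μ : Measure (Euc d)}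
    {a b : ℕ → Euc d → F} {a' b' : Euc d → F}
    (ha : ∀ n, AEStronglyMeasurable (a n - a') μ) (hb : ∀ n, AEStronglyMeasurable (b n - b') μ)
    (h1 : Tendsto (fun n => eLpNorm (a n - a') 2 μ) atTop (𝓝 0))
    (h2 : Tendsto (fun n => eLpNorm (b n - b') 2 μ) atTop (𝓝 0)) :
    Tendsto (fun n => eLpNorm ((a n - b n) - (a' - b')) 2 μ) atTop (𝓝 0) := by
  have h3 := h1.add h2
  rw [add_zero] at h3
  refine tendsto_of_tendsto_of_tendsto_of_le_of_le tendsto_const_nhds h3 (fun n => zero_le) ?_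
  intro n
  have : (a n - b n) - (a' - b') = (a n - a') - (b n - b') := by abel
  simp only [this]
  exact eLpNorm_sub_le (ha n) (hb n) (by norm_num)

lemma IsTrace.sub {d : ℕ} {T : Mesh d} {u v : H1 T.domain} {s t : Euc d → ℝ}
    (hu : IsTrace T u s) (hv : IsTrace T v t) : IsTrace T (u - v) (s - t) := by
  obtain ⟨ms, φ, φc, φ1, φ2, φ3⟩ := hu
  obtain ⟨mt, ψ, ψc, ψ1, ψ2, ψ3⟩ := hv
  refine ⟨ms.sub mt, fun n => φ n - ψ n, fun n => (φc n).sub (ψc n), ?_, ?_, ?_⟩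
  · exact tendsto_eLpNorm_sub
      (fun n => (φc n).continuous.aestronglyMeasurable.sub u.memLp_val.1)
      (fun n => (ψc n).continuous.aestronglyMeasurable.sub v.memLp_val.1) φ1 ψ1
  · have := tendsto_eLpNorm_sub
      (fun n => (continuous_gradient (φc n)).aestronglyMeasurable.sub u.memLp_grad.1)
      (fun n => (continuous_gradient (ψc n)).aestronglyMeasurable.sub v.memLp_grad.1) φ2 ψ2
    simp only [gradient_sub' (φc _) (ψc _)]
    exact this
  · exact tendsto_eLpNorm_sub
      (fun n => (φc n).continuous.aestronglyMeasurable.sub ms.1)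
      (fun n => (ψc n).continuous.aestronglyMeasurable.sub mt.1) φ3 ψ3

instance {d : ℕ} (P : Problem d) : Sub P.V where
  sub u v :=
    { toH1 := u.toH1 - v.toH1
      trace := u.trace - v.trace
      isTrace := u.isTrace.sub v.isTrace
      vanish := by
        filter_upwards [u.vanish, v.vanish] with x hx hy
        simp [hx, hy] }

end ReactionDiffusion

end

/-!
Let `e = u - u_h`. Testing the weak formulation and the definition of the normal trace with `e`, and
splitting over the elements, gives

`|||e|||² = ∑_K [(ε, ∇e)_K + (r, e)_K + ∑_γ (R_N, e)_γ + (f - Π f, e)_K + ∑_γ (g_N - Π_γ g_N, e)_γ]`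

(`Problem.bilin_error_eq`). If `κ_K = 0`, then `r` and `R_N` vanish by equilibration. Since the
projections are onto spaces which contain the constants, `e` can be replaced by `e` minus its mean
value on `K` in the last two terms. The Cauchy–Schwarz inequality on each element, and then for the
sum, reduces the theorem to two inequalities on a simplex `K` of diameter `h`.

* The trace inequality (`setIntegral_facet_sq`, `IsTrace.trace_le`). If `a` is the vertex opposite
  to the facet `γ`, then the field `x - a` is tangential to the other facets and has a constant
  normal component on `γ`, so that the integral of `v²` over `γ` is `|γ| / (d |K|)` times the integral
  over `K` of `div ((x - a) v²) = d v² + 2 v (x - a)·∇v`. The divergence theorem is replaced by an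
  integration along the segments from `a` to `γ` (`exists_restrict_hull_eq_map`).
* The Poincaré inequality `‖v - v̄‖_K ≤ (h / π) ‖∇v‖_K`. Instead of the optimal inequality of Payne and
  Weinberger for convex domains, a better one for simplices is used (`simplex_poincare`), with
  `h² / (4 (d + 1)) ≤ h² / 12 < h² / π²` in place of `h² / π²`. Give independent exponentially
  distributed weights to the vertices: their center of mass `y` is uniformly distributed in `K` and
  independent of the total weight `S` (`map_pi_expo`). An exponential variable satisfies
  `Var g ≤ E [X g'(X)²]` (`expo_poincare`), and so do independent ones, with a sum over the variables
  (`pi_expo_poincare`). For `g = S v(y)` with `v̄ = 0` this is the Poincaré inequality with the weight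
  `∑ λ_i (∇v·(a_i - y))²` on the right-hand side, where `λ_i` are the barycentric coordinates; the
  weight is the variance of a quantity with range at most `h |∇v|`, hence at most `h² |∇v|² / 4`.

Both inequalities hold for smooth functions, and then in `H¹(Ω)` because the definition of the trace
provides smooth approximations whose values, gradients and boundary values converge in `L²`.
-/

noncomputable section

namespace ReactionDiffusion

/-! ### The weighted Poincaré inequality for the exponential distribution -/

/-- The standard exponential distribution, with density `exp (-t)` on `(0, ∞)`. -/
def expo : Measure ℝ :=
  (volume.restrict (Set.Ioi 0)).withDensity fun t => ENNReal.ofReal (Real.exp (-t))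

lemma lintegral_expo {f : ℝ → ℝ≥0∞} (hf : Measurable f) :
    ∫⁻ t, f t ∂expo = ∫⁻ t in Set.Ioi 0, ENNReal.ofReal (Real.exp (-t)) * f t := by
  rw [expo, lintegral_withDensity_eq_lintegral_mul _ (by fun_prop) hf]
  rfl

instance : SFinite expo := by unfold expo; infer_instance

lemma ae_expo_pos : ∀ᵐ t ∂expo, 0 < t :=
  (withDensity_absolutelyContinuous _ _).ae_le (ae_restrict_mem measurableSet_Ioi)

/-- The antiderivative is `-(y - x + 1) exp (-y)`. -/
lemma lintegral_Ioi_sub_mul_exp {x t : ℝ} (hxt : x ≤ t) :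
    ∫⁻ y in Set.Ioi t, ENNReal.ofReal (Real.exp (-y)) * ENNReal.ofReal (y - x) =
      ENNReal.ofReal ((t + 1 - x) * Real.exp (-t)) := by
  have hd : ∀ y ∈ Set.Ici t, HasDerivAt (fun y => -((y - x + 1) * Real.exp (-y)))
      (Real.exp (-y) * (y - x)) y := by
    intro y _
    have h1 : HasDerivAt (fun y : ℝ => y - x + 1) 1 y := ((hasDerivAt_id y).sub_const x).add_const 1
    have h2 : HasDerivAt (fun y : ℝ => Real.exp (-y)) (-Real.exp (-y)) y := by
      simpa using (hasDerivAt_neg y).exp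
    refine (h1.mul h2).neg.congr_deriv ?_
    ring
  have hl : Tendsto (fun y => -((y - x + 1) * Real.exp (-y))) atTop (𝓝 0) := by
    have h1 := Real.tendsto_pow_mul_exp_neg_atTop_nhds_zero 1
    have h0 := (Real.tendsto_pow_mul_exp_neg_atTop_nhds_zero 0).const_mul (1 - x)
    have := (h1.add h0).neg
    simp only [mul_zero, add_zero, neg_zero] at this
    refine this.congr fun y => ?_
    ring
  have hpos : ∀ y ∈ Set.Ioi t, 0 ≤ Real.exp (-y) * (y - x) := fun y hy =>
    mul_nonneg (Real.exp_nonneg _) (by have := Set.mem_Ioi.1 hy; linarith)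
  have hi := integrableOn_Ioi_deriv_of_nonneg' hd hpos hl
  have he := integral_Ioi_of_hasDerivAt_of_nonneg' hd hpos hl
  have := ofReal_integral_eq_lintegral_ofReal hi (ae_restrict_of_forall_mem measurableSet_Ioi hpos)
  rw [he] at this
  rw [show (t + 1 - x) * Real.exp (-t) = 0 - -((t - x + 1) * Real.exp (-t)) by ring, this]
  refine lintegral_congr fun y => ?_
  rw [ENNReal.ofReal_mul (Real.exp_nonneg _)]

/-- The antiderivative is `(x - t) exp (-x)`. -/
lemma lintegral_Ioo_exp_mul {t : ℝ} (ht : 0 ≤ t) :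
    ∫⁻ x in Set.Ioo 0 t, ENNReal.ofReal (Real.exp (-x) * (t + 1 - x)) = ENNReal.ofReal t := by
  have hd : ∀ x ∈ Set.uIcc 0 t, HasDerivAt (fun x => (x - t) * Real.exp (-x))
      (Real.exp (-x) * (t + 1 - x)) x := by
    intro x _
    have h1 : HasDerivAt (fun x : ℝ => x - t) 1 x := (hasDerivAt_id x).sub_const t
    have h2 : HasDerivAt (fun x : ℝ => Real.exp (-x)) (-Real.exp (-x)) x := by
      simpa using (hasDerivAt_neg x).exp
    refine (h1.mul h2).congr_deriv ?_
    ring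
  have hc : Continuous fun x => Real.exp (-x) * (t + 1 - x) := by fun_prop
  have he := intervalIntegral.integral_eq_sub_of_hasDerivAt hd (hc.intervalIntegrable _ _)
  rw [intervalIntegral.integral_of_le ht, integral_Ioc_eq_integral_Ioo] at he
  have hi : IntegrableOn (fun x => Real.exp (-x) * (t + 1 - x)) (Set.Ioo 0 t) :=
    (hc.integrableOn_Icc (a := 0) (b := t)).mono_set Set.Ioo_subset_Icc_self
  rw [← ofReal_integral_eq_lintegral_ofReal hi, he]
  · simp
  · refine ae_restrict_of_forall_mem measurableSet_Ioo fun x hx => ?_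
    exact mul_nonneg (Real.exp_nonneg _) (by linarith [hx.2])

/-- The Cauchy–Schwarz inequality for `g y - g x = ∫ g'`. -/
lemma sq_sub_le_of_hasDerivAt {g g' : ℝ → ℝ} {x y : ℝ} (hxy : x < y)
    (hg : ∀ t ∈ Set.Icc x y, HasDerivAt g (g' t) t) (hc : ContinuousOn g' (Set.Icc x y)) :
    ENNReal.ofReal ((g x - g y) ^ 2) ≤
      ENNReal.ofReal (y - x) * ∫⁻ t in Set.Ioo x y, ENNReal.ofReal (g' t ^ 2) := by
  have hu : Set.uIcc x y = Set.Icc x y := Set.uIcc_of_le hxy.le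
  have i1 : IntervalIntegrable g' volume x y := (hu ▸ hc).intervalIntegrable
  have i2 : IntervalIntegrable (fun t => g' t ^ 2) volume x y :=
    (hu ▸ hc.pow 2 : ContinuousOn (fun t => g' t ^ 2) (Set.uIcc x y)).intervalIntegrable
  have he := intervalIntegral.integral_eq_sub_of_hasDerivAt (hu ▸ hg) i1
  -- `c` is the mean value of `g'`, and the claim is that the variance of `g'` is nonnegative
  set c := (g y - g x) / (y - x) with hcdef
  have h0 : 0 ≤ ∫ t in x..y, (g' t - c) ^ 2 :=
    intervalIntegral.integral_nonneg hxy.le fun t _ => sq_nonneg _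
  have h1 : ∫ t in x..y, (g' t - c) ^ 2 =
      (∫ t in x..y, g' t ^ 2) - 2 * c * (g y - g x) + c ^ 2 * (y - x) := by
    rw [← he, ← intervalIntegral.integral_const_mul]
    have : (∫ t in x..y, c ^ 2) = c ^ 2 * (y - x) := by simp [mul_comm]
    rw [← this, ← intervalIntegral.integral_sub i2 (i1.const_mul _),
      ← intervalIntegral.integral_add (i2.sub (i1.const_mul _)) (by simp)]
    refine intervalIntegral.integral_congr fun t _ => ?_
    ring
  have hp : 0 < y - x := sub_pos.2 hxy
  have hcm : c * (y - x) = g y - g x := by rw [hcdef]; field_simp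
  have h2 : (g x - g y) ^ 2 ≤ (y - x) * ∫ t in Set.Ioo x y, g' t ^ 2 := by
    rw [← integral_Ioc_eq_integral_Ioo, ← intervalIntegral.integral_of_le hxy.le]
    have h3 := mul_nonneg hp.le (h1 ▸ h0)
    have h4 : (g x - g y) ^ 2 = (c * (y - x)) ^ 2 := by rw [hcm]; ring
    rw [← hcm] at h3
    rw [h4]
    nlinarith
  have i3 : IntegrableOn (fun t => g' t ^ 2) (Set.Ioo x y) :=
    ((hc.pow 2).integrableOn_Icc).mono_set Set.Ioo_subset_Icc_self
  rw [← ofReal_integral_eq_lintegral_ofReal i3 (ae_of_all _ fun t => sq_nonneg _),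
    ← ENNReal.ofReal_mul hp.le]
  exact ENNReal.ofReal_le_ofReal h2

/-- The kernel which collects the contributions of `t ∈ (x, y)` to `(g x - g y)²`. -/
def crossing (x y t : ℝ) : ℝ≥0∞ := if x < t ∧ t < y then ENNReal.ofReal (y - x) else 0

lemma measurable_crossing {α : Type*} [MeasurableSpace α] {x y t : α → ℝ} (hx : Measurable x)
    (hy : Measurable y) (ht : Measurable t) : Measurable fun a => crossing (x a) (y a) (t a) :=
  Measurable.ite ((measurableSet_lt hx ht).inter (measurableSet_lt ht hy)) (by fun_prop)
    measurable_const

/-- For independent exponential `x` and `y`, the kernel averages to the weight `t` times the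
density `exp (-t)`; this is where the weight in `expo_poincare` comes from. -/
lemma lintegral_crossing {t : ℝ} (ht : 0 < t) :
    ∫⁻ x, ∫⁻ y, crossing x y t ∂expo ∂expo = ENNReal.ofReal (t * Real.exp (-t)) := by
  have h_inner : ∀ x, 0 < x → ∫⁻ y, crossing x y t ∂expo =
      (Set.Iio t).indicator (fun x => ENNReal.ofReal ((t + 1 - x) * Real.exp (-t))) x := by
    intro x hx
    rw [lintegral_expo (measurable_crossing measurable_const measurable_id' measurable_const)]
    by_cases hxt : x < t
    · rw [Set.indicator_of_mem (Set.mem_Iio.2 hxt), ← lintegral_Ioi_sub_mul_exp hxt.le,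
        ← lintegral_indicator measurableSet_Ioi, ← lintegral_indicator measurableSet_Ioi]
      refine lintegral_congr fun y => ?_
      by_cases hy : t < y
      · simp [crossing, hxt, hy, ht.trans hy]
      · simp [crossing, hy]
    · simp [crossing, hxt]
  rw [lintegral_congr_ae (ae_expo_pos.mono h_inner),
    lintegral_expo (Measurable.indicator (by fun_prop) measurableSet_Iio),
    mul_comm t, ENNReal.ofReal_mul (Real.exp_nonneg _), ← lintegral_Ioo_exp_mul ht.le,
    ← lintegral_const_mul _ (by fun_prop), ← lintegral_indicator measurableSet_Ioi,
    ← lintegral_indicator measurableSet_Ioo]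
  refine lintegral_congr fun x => ?_
  by_cases h0 : 0 < x <;> by_cases h1 : x < t <;> simp [h0, h1]
  rw [← ENNReal.ofReal_mul (Real.exp_nonneg _), ← ENNReal.ofReal_mul (Real.exp_nonneg _)]
  congr 1; ring

/-- The sharp weighted Poincaré inequality for the exponential distribution: the
Cauchy–Schwarz inequality on `[x, y]`, integrated over all `x` and `y`. -/
theorem expo_poincare {g g' : ℝ → ℝ} (hg : ∀ t, 0 < t → HasDerivAt g (g' t) t)
    (hc : ContinuousOn g' (Set.Ioi 0)) (hm' : Measurable g') :
    ∫⁻ x, ∫⁻ y, ENNReal.ofReal ((g x - g y) ^ 2) ∂expo ∂expo ≤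
      2 * ∫⁻ t, ENNReal.ofReal (t * g' t ^ 2) ∂expo := by
  have key : ∀ x y : ℝ, 0 < x → 0 < y → ENNReal.ofReal ((g x - g y) ^ 2) ≤
      ∫⁻ t in Set.Ioi 0, ENNReal.ofReal (g' t ^ 2) * (crossing x y t + crossing y x t) := by
    have main : ∀ x y : ℝ, 0 < x → x < y → ENNReal.ofReal ((g x - g y) ^ 2) ≤
        ∫⁻ t in Set.Ioi 0, ENNReal.ofReal (g' t ^ 2) * crossing x y t := by
      intro x y hx hxy
      have hsub : Set.Icc x y ⊆ Set.Ioi 0 := fun t ht => hx.trans_le ht.1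
      refine (sq_sub_le_of_hasDerivAt hxy (fun t ht => hg t (hsub ht)) (hc.mono hsub)).trans ?_
      rw [← lintegral_const_mul _ (by fun_prop), ← lintegral_indicator measurableSet_Ioi,
        ← lintegral_indicator measurableSet_Ioo]
      refine lintegral_mono fun t => ?_
      by_cases h1 : x < t <;> by_cases h2 : t < y <;> simp [crossing, h1, h2]
      simp [hx.trans h1, h1, h2, mul_comm]
    intro x y hx hy
    rcases lt_trichotomy x y with h | h | h
    · refine (main x y hx h).trans (lintegral_mono fun t => ?_)
      gcongr
      exact le_self_add
    · simp [h]
    · rw [show (g x - g y) ^ 2 = (g y - g x) ^ 2 by ring]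
      refine (main y x hy h).trans (lintegral_mono fun t => ?_)
      gcongr
      exact le_add_self
  have m1 : Measurable fun p : ℝ × ℝ × ℝ =>
      ENNReal.ofReal (g' p.2.2 ^ 2) * (crossing p.1 p.2.1 p.2.2 + crossing p.2.1 p.1 p.2.2) := by
    exact (by fun_prop : Measurable fun p : ℝ × ℝ × ℝ => ENNReal.ofReal (g' p.2.2 ^ 2)).mul
      ((measurable_crossing (by fun_prop) (by fun_prop) (by fun_prop)).add
        (measurable_crossing (by fun_prop) (by fun_prop) (by fun_prop)))
  calc ∫⁻ x, ∫⁻ y, ENNReal.ofReal ((g x - g y) ^ 2) ∂expo ∂expo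
      ≤ ∫⁻ x, ∫⁻ y, (∫⁻ t in Set.Ioi 0, ENNReal.ofReal (g' t ^ 2) *
          (crossing x y t + crossing y x t)) ∂expo ∂expo := by
        refine lintegral_mono_ae ?_
        filter_upwards [ae_expo_pos] with x hx
        exact lintegral_mono_ae (ae_expo_pos.mono fun y hy => key x y hx hy)
    _ = ∫⁻ t in Set.Ioi 0, (∫⁻ x, ∫⁻ y, ENNReal.ofReal (g' t ^ 2) *
          (crossing x y t + crossing y x t) ∂expo ∂expo) := by
        have e1 : ∀ x, ∫⁻ y, (∫⁻ t in Set.Ioi 0, ENNReal.ofReal (g' t ^ 2) *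
            (crossing x y t + crossing y x t)) ∂expo = ∫⁻ t in Set.Ioi 0, ∫⁻ y,
            ENNReal.ofReal (g' t ^ 2) * (crossing x y t + crossing y x t) ∂expo := by
          intro x
          exact lintegral_lintegral_swap (f := fun y t => ENNReal.ofReal (g' t ^ 2) *
            (crossing x y t + crossing y x t))
            (m1.comp (measurable_prodMk_left (x := x))).aemeasurable
        rw [lintegral_congr e1, lintegral_lintegral_swap]
        have : Measurable fun p : (ℝ × ℝ) × ℝ => ENNReal.ofReal (g' p.1.2 ^ 2) *
            (crossing p.1.1 p.2 p.1.2 + crossing p.2 p.1.1 p.1.2) :=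
          m1.comp (by fun_prop : Measurable fun p : (ℝ × ℝ) × ℝ => (p.1.1, p.2, p.1.2))
        exact this.lintegral_prod_right'.aemeasurable
    _ = ∫⁻ t in Set.Ioi 0, 2 * (ENNReal.ofReal (Real.exp (-t)) *
          ENNReal.ofReal (t * g' t ^ 2)) := by
        refine setLIntegral_congr_fun measurableSet_Ioi fun t ht => ?_
        have hm : Measurable fun p : ℝ × ℝ => crossing p.1 p.2 t :=
          measurable_crossing measurable_fst measurable_snd measurable_const
        have hm2 : Measurable fun p : ℝ × ℝ => crossing p.2 p.1 t := hm.comp measurable_swap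
        have hb : ∫⁻ x, ∫⁻ y, crossing y x t ∂expo ∂expo =
            ENNReal.ofReal (t * Real.exp (-t)) := by
          rw [lintegral_lintegral_swap hm2.aemeasurable, lintegral_crossing ht]
        have e1 : ∀ x, ∫⁻ y, ENNReal.ofReal (g' t ^ 2) *
            (crossing x y t + crossing y x t) ∂expo = ENNReal.ofReal (g' t ^ 2) *
            (∫⁻ y, crossing x y t ∂expo + ∫⁻ y, crossing y x t ∂expo) := by
          intro x
          have a1 : Measurable fun y => crossing x y t := hm.comp measurable_prodMk_left
          have a2 : Measurable fun y => crossing y x t := hm2.comp measurable_prodMk_left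
          rw [lintegral_const_mul _ (by exact a1.add a2), lintegral_add_left a1]
        simp only [e1]
        have b1 : Measurable fun x => ∫⁻ y, crossing x y t ∂expo := hm.lintegral_prod_right'
        have b2 : Measurable fun x => ∫⁻ y, crossing y x t ∂expo := hm2.lintegral_prod_right'
        rw [lintegral_const_mul _ (by exact b1.add b2), lintegral_add_left b1, lintegral_crossing ht, hb,
          ENNReal.ofReal_mul (le_of_lt ht), ENNReal.ofReal_mul (le_of_lt ht)]
        ring
    _ = 2 * ∫⁻ t, ENNReal.ofReal (t * g' t ^ 2) ∂expo := by
        rw [lintegral_const_mul _ (by fun_prop), lintegral_expo (by fun_prop)]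

/-! ### Tensorization -/

instance : IsProbabilityMeasure expo := by
  refine ⟨?_⟩
  have h := lintegral_expo (f := fun _ => 1) measurable_const
  simp only [lintegral_const, one_mul, mul_one] at h
  rw [h, ← ofReal_integral_eq_lintegral_ofReal _ (ae_of_all _ fun _ => Real.exp_nonneg _),
    integral_exp_neg_Ioi_zero, ENNReal.ofReal_one]
  exact integrableOn_exp_neg_Ioi 0

/-- The variance is subadditive for products. It is stated for the double integral of
`(h p - h q)²`, which is twice the variance, so that no integrability is needed; it follows from
`(a - d)² + (b - c)² ≤ (a - b)² + (a - c)² + (b - d)² + (c - d)²`. -/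
lemma lintegral_sq_sub_prod_le {α β : Type*} [MeasurableSpace α] [MeasurableSpace β]
    (μ : Measure α) (ν : Measure β) [IsProbabilityMeasure μ] [IsProbabilityMeasure ν]
    {h : α × β → ℝ} (hh : Measurable h) :
    ∫⁻ p, ∫⁻ q, ENNReal.ofReal ((h p - h q) ^ 2) ∂(μ.prod ν) ∂(μ.prod ν) ≤
      ∫⁻ z, ∫⁻ t, ∫⁻ t', ENNReal.ofReal ((h (t, z) - h (t', z)) ^ 2) ∂μ ∂μ ∂ν +
      ∫⁻ t, ∫⁻ z, ∫⁻ z', ENNReal.ofReal ((h (t, z) - h (t, z')) ^ 2) ∂ν ∂ν ∂μ := by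
  obtain ⟨I, hI⟩ : ∃ I : (α → α → β → β → ℝ≥0∞) → ℝ≥0∞, I = fun F =>
    ∫⁻ p : α × α, ∫⁻ q : β × β, F p.1 p.2 q.1 q.2 ∂(ν.prod ν) ∂(μ.prod μ) := ⟨_, rfl⟩
  have hL : ∫⁻ p, ∫⁻ q, ENNReal.ofReal ((h p - h q) ^ 2) ∂(μ.prod ν) ∂(μ.prod ν) =
      I fun t t' z z' => ENNReal.ofReal ((h (t, z) - h (t', z')) ^ 2) := by
    simp only [hI]
    rw [lintegral_prod _ (by fun_prop), lintegral_prod _ (by fun_prop)]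
    refine lintegral_congr fun t => ?_
    have e1 : ∀ z, ∫⁻ q, ENNReal.ofReal ((h (t, z) - h q) ^ 2) ∂(μ.prod ν) =
        ∫⁻ t', ∫⁻ z', ENNReal.ofReal ((h (t, z) - h (t', z')) ^ 2) ∂ν ∂μ := fun z =>
      lintegral_prod _ (by fun_prop)
    rw [lintegral_congr e1, lintegral_lintegral_swap (by fun_prop)]
    refine lintegral_congr fun t' => ?_
    rw [lintegral_prod _ (by fun_prop)]
  have hS : (I fun t t' z z' => ENNReal.ofReal ((h (t', z) - h (t, z')) ^ 2)) =
      I fun t t' z z' => ENNReal.ofReal ((h (t, z) - h (t', z')) ^ 2) := by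
    simp only [hI]
    refine lintegral_congr fun p => ?_
    rw [← lintegral_prod_swap]
    refine lintegral_congr fun q => ?_
    congr 1
    simp only [Prod.fst_swap, Prod.snd_swap]
    ring
  have hX1 : (I fun t t' z z' => ENNReal.ofReal ((h (t, z) - h (t', z)) ^ 2)) =
      ∫⁻ z, ∫⁻ t, ∫⁻ t', ENNReal.ofReal ((h (t, z) - h (t', z)) ^ 2) ∂μ ∂μ ∂ν := by
    simp only [hI]
    have e1 : ∀ z, ∫⁻ t, ∫⁻ t', ENNReal.ofReal ((h (t, z) - h (t', z)) ^ 2) ∂μ ∂μ =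
        ∫⁻ p : α × α, ENNReal.ofReal ((h (p.1, z) - h (p.2, z)) ^ 2) ∂(μ.prod μ) := fun z =>
      (lintegral_prod (fun p : α × α => ENNReal.ofReal ((h (p.1, z) - h (p.2, z)) ^ 2))
        (by fun_prop)).symm
    rw [lintegral_congr e1, lintegral_lintegral_swap (μ := ν) (ν := μ.prod μ) (by fun_prop)]
    refine lintegral_congr fun p => ?_
    rw [lintegral_prod _ (by fun_prop)]
    simp
  have hX2 : (I fun t t' z z' => ENNReal.ofReal ((h (t, z') - h (t', z')) ^ 2)) =
      ∫⁻ z, ∫⁻ t, ∫⁻ t', ENNReal.ofReal ((h (t, z) - h (t', z)) ^ 2) ∂μ ∂μ ∂ν := by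
    rw [← hX1]
    simp only [hI]
    refine lintegral_congr fun p => ?_
    rw [← lintegral_prod_swap]
    rfl
  have hY1 : (I fun t t' z z' => ENNReal.ofReal ((h (t, z) - h (t, z')) ^ 2)) =
      ∫⁻ t, ∫⁻ z, ∫⁻ z', ENNReal.ofReal ((h (t, z) - h (t, z')) ^ 2) ∂ν ∂ν ∂μ := by
    simp only [hI]
    rw [lintegral_prod _ (by fun_prop)]
    refine lintegral_congr fun t => ?_
    simp only [lintegral_const, measure_univ, mul_one]
    rw [lintegral_prod _ (by fun_prop)]
  have hY2 : (I fun t t' z z' => ENNReal.ofReal ((h (t', z) - h (t', z')) ^ 2)) =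
      ∫⁻ t, ∫⁻ z, ∫⁻ z', ENNReal.ofReal ((h (t, z) - h (t, z')) ^ 2) ∂ν ∂ν ∂μ := by
    rw [← hY1]
    simp only [hI]
    rw [← lintegral_prod_swap]
    rfl
  set D := ∫⁻ p, ∫⁻ q, ENNReal.ofReal ((h p - h q) ^ 2) ∂(μ.prod ν) ∂(μ.prod ν)
  set X := ∫⁻ z, ∫⁻ t, ∫⁻ t', ENNReal.ofReal ((h (t, z) - h (t', z)) ^ 2) ∂μ ∂μ ∂ν
  set Y := ∫⁻ t, ∫⁻ z, ∫⁻ z', ENNReal.ofReal ((h (t, z) - h (t, z')) ^ 2) ∂ν ∂ν ∂μ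
  have hadd : ∀ (F G : α → α → β → β → ℝ≥0∞),
      (Measurable fun p : (α × α) × (β × β) => F p.1.1 p.1.2 p.2.1 p.2.2) →
      (I fun t t' z z' => F t t' z z' + G t t' z z') = I F + I G := by
    intro F G hF
    simp only [hI]
    rw [← lintegral_add_left hF.lintegral_prod_right']
    refine lintegral_congr fun p => ?_
    exact lintegral_add_left (hF.comp measurable_prodMk_left) _
  have hmain : D + D ≤ X + (Y + (Y + X)) := by
    have hD : D + D = I fun t t' z z' => ENNReal.ofReal ((h (t, z) - h (t', z')) ^ 2) +
        ENNReal.ofReal ((h (t', z) - h (t, z')) ^ 2) := by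
      refine Eq.trans ?_ (hadd (fun t t' z z' => ENNReal.ofReal ((h (t, z) - h (t', z')) ^ 2))
        (fun t t' z z' => ENNReal.ofReal ((h (t', z) - h (t, z')) ^ 2)) (by fun_prop)).symm
      rw [hS, ← hL]
    have hR : X + (Y + (Y + X)) = I fun t t' z z' => ENNReal.ofReal ((h (t, z) - h (t', z)) ^ 2) +
        (ENNReal.ofReal ((h (t, z) - h (t, z')) ^ 2) +
        (ENNReal.ofReal ((h (t', z) - h (t', z')) ^ 2) +
          ENNReal.ofReal ((h (t, z') - h (t', z')) ^ 2))) := by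
      refine Eq.trans ?_ (hadd (fun t t' z z' => ENNReal.ofReal ((h (t, z) - h (t', z)) ^ 2))
        (fun t t' z z' => ENNReal.ofReal ((h (t, z) - h (t, z')) ^ 2) +
          (ENNReal.ofReal ((h (t', z) - h (t', z')) ^ 2) +
          ENNReal.ofReal ((h (t, z') - h (t', z')) ^ 2))) (by fun_prop)).symm
      rw [hX1, hadd (fun t t' z z' => ENNReal.ofReal ((h (t, z) - h (t, z')) ^ 2))
        (fun t t' z z' => ENNReal.ofReal ((h (t', z) - h (t', z')) ^ 2) +
          ENNReal.ofReal ((h (t, z') - h (t', z')) ^ 2)) (by fun_prop), hY1,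
        hadd (fun t t' z z' => ENNReal.ofReal ((h (t', z) - h (t', z')) ^ 2))
        (fun t t' z z' => ENNReal.ofReal ((h (t, z') - h (t', z')) ^ 2)) (by fun_prop), hY2, hX2]
    rw [hD, hR]
    simp only [hI]
    refine lintegral_mono fun p => lintegral_mono fun q => ?_
    simp only
    rw [← ENNReal.ofReal_add (sq_nonneg _) (sq_nonneg _),
      ← ENNReal.ofReal_add (sq_nonneg _) (sq_nonneg _),
      ← ENNReal.ofReal_add (sq_nonneg _) (by positivity),
      ← ENNReal.ofReal_add (sq_nonneg _) (by positivity)]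
    refine ENNReal.ofReal_le_ofReal ?_
    nlinarith [sq_nonneg (h (p.1, q.1) - h (p.2, q.1) - h (p.1, q.2) + h (p.2, q.2))]
  have h2 : 2 * D ≤ 2 * (X + Y) := by
    convert hmain using 1 <;> ring
  exact (ENNReal.mul_le_mul_iff_right (by simp) (by simp)).1 h2

lemma measurable_cons {n : ℕ} :
    Measurable fun p : ℝ × (Fin n → ℝ) => (Fin.cons p.1 p.2 : Fin (n + 1) → ℝ) :=
  measurable_pi_iff.2 fun j => by
    refine Fin.cases ?_ (fun j => ?_) j
    · simpa using measurable_fst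
    · simp only [Fin.cons_succ]
      fun_prop

lemma lintegral_pi_cons {n : ℕ} (μ : Measure ℝ) [SigmaFinite μ] {F : (Fin (n + 1) → ℝ) → ℝ≥0∞}
    (hF : Measurable F) :
    ∫⁻ x, F x ∂(Measure.pi fun _ => μ) =
      ∫⁻ p : ℝ × (Fin n → ℝ), F (Fin.cons p.1 p.2) ∂(μ.prod (Measure.pi fun _ => μ)) := by
  rw [← (measurePreserving_piFinSuccAbove (fun _ : Fin (n + 1) => μ) 0).symm.lintegral_comp hF]
  simp [MeasurableEquiv.piFinSuccAbove, Fin.consEquiv]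

lemma ae_pi_expo_pos {n : ℕ} :
    ∀ᵐ z : Fin n → ℝ ∂(Measure.pi fun _ => expo), ∀ j, 0 < z j :=
  ae_all_iff.2 fun j =>
    (Measure.quasiMeasurePreserving_eval (fun _ : Fin n => expo) j).ae ae_expo_pos

/-- The weighted Poincaré inequality for independent exponential variables. -/
theorem pi_expo_poincare : ∀ {n : ℕ} {g : (Fin n → ℝ) → ℝ} {G : Fin n → (Fin n → ℝ) → ℝ},
    Measurable g → (∀ i, Measurable (G i)) →
    (∀ x, (∀ j, 0 < x j) → ∀ i,
      HasDerivAt (fun t => g (Function.update x i t)) (G i x) (x i)) →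
    (∀ i, ContinuousOn (G i) {x | ∀ j, 0 < x j}) →
    ∫⁻ x, ∫⁻ y, ENNReal.ofReal ((g x - g y) ^ 2)
        ∂(Measure.pi fun _ => expo) ∂(Measure.pi fun _ => expo) ≤
      2 * ∑ i, ∫⁻ x, ENNReal.ofReal (x i * G i x ^ 2) ∂(Measure.pi fun _ => expo) := by
  intro n
  induction n with
  | zero =>
    intro g G _ _ _ _
    have : ∀ x y, ENNReal.ofReal ((g x - g y) ^ 2) = 0 := fun x y => by
      rw [Subsingleton.elim x y]; simp
    simp [this]
  | succ n ih =>
    intro g G hg hG hd hc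
    have hcons := measurable_cons (n := n)
    have tr : ∀ {F : (Fin (n + 1) → ℝ) → ℝ≥0∞}, Measurable F → _ :=
      fun hF => lintegral_pi_cons expo hF
    have hcp : ∀ {t : ℝ} {z : Fin n → ℝ}, 0 < t → (∀ j, 0 < z j) →
        ∀ j, 0 < (Fin.cons t z : Fin (n + 1) → ℝ) j := fun ht hz j => by
      refine Fin.cases ?_ (fun j => ?_) j <;> simp [ht, hz]
    have hL : ∫⁻ x, ∫⁻ y, ENNReal.ofReal ((g x - g y) ^ 2)
        ∂(Measure.pi fun _ => expo) ∂(Measure.pi fun _ => expo) =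
        ∫⁻ p : ℝ × (Fin n → ℝ), ∫⁻ q : ℝ × (Fin n → ℝ),
          ENNReal.ofReal ((g (Fin.cons p.1 p.2) - g (Fin.cons q.1 q.2)) ^ 2)
          ∂(expo.prod (Measure.pi fun _ => expo)) ∂(expo.prod (Measure.pi fun _ => expo)) := by
      rw [tr (by fun_prop)]
      refine lintegral_congr fun p => ?_
      rw [tr (by fun_prop)]
    rw [hL]
    refine (lintegral_sq_sub_prod_le expo (Measure.pi fun _ => expo)
      (h := fun p => g (Fin.cons p.1 p.2)) (hg.comp hcons)).trans ?_
    rw [Fin.sum_univ_succ, mul_add]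
    refine add_le_add ?_ ?_
    · rw [tr (by fun_prop), lintegral_prod_symm _ (by
        have := (hG 0).comp hcons
        simp only [Fin.cons_zero]
        fun_prop), ← lintegral_const_mul' _ _ (by simp)]
      refine lintegral_mono_ae (ae_pi_expo_pos.mono fun z hz => ?_)
      refine (expo_poincare (g := fun t => g (Fin.cons t z)) (g' := fun t => G 0 (Fin.cons t z))
        (fun t ht => ?_) ?_ ((hG 0).comp (hcons.comp measurable_prodMk_right))).trans_eq ?_
      · have := hd (Fin.cons t z) (hcp ht hz) 0
        simpa only [Fin.update_cons_zero, Fin.cons_zero] using this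
      · refine (hc 0).comp (Continuous.continuousOn ?_) fun t ht => hcp ht hz
        refine continuous_pi fun j => ?_
        refine Fin.cases ?_ (fun j => ?_) j
        · simpa using continuous_id'
        · simpa using continuous_const
      · simp
    · have h2 : ∀ i : Fin n, ∫⁻ x, ENNReal.ofReal (x i.succ * G i.succ x ^ 2)
          ∂(Measure.pi fun _ => expo) = ∫⁻ t, ∫⁻ z : Fin n → ℝ,
            ENNReal.ofReal (z i * G i.succ (Fin.cons t z) ^ 2)
            ∂(Measure.pi fun _ => expo) ∂expo := by
        intro i
        have := (hG i.succ).comp hcons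
        rw [tr (by fun_prop), lintegral_prod _ (by
          simp only [Fin.cons_succ]
          fun_prop)]
        simp
      rw [Finset.sum_congr rfl fun i _ => h2 i, ← lintegral_finsetSum,
        ← lintegral_const_mul' _ _ (by simp)]
      · refine lintegral_mono_ae (ae_expo_pos.mono fun t ht => ?_)
        have hct : Measurable fun z : Fin n → ℝ => (Fin.cons t z : Fin (n + 1) → ℝ) :=
          hcons.comp measurable_prodMk_left
        refine ih (g := fun z => g (Fin.cons t z)) (G := fun i z => G i.succ (Fin.cons t z))
          (hg.comp hct) (fun i => (hG i.succ).comp hct) (fun z hz i => ?_) fun i => ?_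
        · have := hd (Fin.cons t z) (hcp ht hz) i.succ
          simpa only [Fin.cons_update, Fin.cons_succ] using this
        · refine (hc i.succ).comp (Continuous.continuousOn ?_) fun z hz => hcp ht hz
          refine continuous_pi fun j => ?_
          refine Fin.cases ?_ (fun j => ?_) j
          · simpa using continuous_const
          · simpa using continuous_apply j
      · intro i _
        have := (hG i.succ).comp hcons
        have h3 : Measurable fun p : ℝ × (Fin n → ℝ) =>
          ENNReal.ofReal (p.2 i * G i.succ (Fin.cons p.1 p.2) ^ 2) := by fun_prop
        exact h3.lintegral_prod_right'

/-! ### Simplices and exponential weights -/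

/-- Integration over a cone in polar form: the section at height `t` of the cone is `t • C`. -/
lemma lintegral_cone {W : Type*} [NormedAddCommGroup W] [NormedSpace ℝ W] [FiniteDimensional ℝ W]
    [MeasurableSpace W] [BorelSpace W] (μ : Measure W) [μ.IsAddHaarMeasure]
    {I : Set ℝ} (hI : MeasurableSet I) (hpos : I ⊆ Set.Ioi 0) {C : Set W} (hC : MeasurableSet C)
    {F : ℝ × W → ℝ≥0∞} (hF : Measurable F) :
    ∫⁻ p in {p : ℝ × W | p.1 ∈ I ∧ p.1⁻¹ • p.2 ∈ C}, F p ∂(volume.prod μ) =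
      ∫⁻ t in I, ENNReal.ofReal (t ^ Module.finrank ℝ W) * ∫⁻ z in C, F (t, t • z) ∂μ := by
  have hS : MeasurableSet {p : ℝ × W | p.1 ∈ I ∧ p.1⁻¹ • p.2 ∈ C} :=
    (measurable_fst hI).inter ((measurable_fst.inv.smul measurable_snd) hC)
  rw [← lintegral_indicator hS, lintegral_prod _ (hF.indicator hS).aemeasurable,
    ← lintegral_indicator hI]
  refine lintegral_congr fun t => ?_
  by_cases ht : t ∈ I
  · have ht0 : 0 < t := hpos ht
    rw [Set.indicator_of_mem ht]
    have hH : Measurable fun z => C.indicator (fun z => F (t, t • z)) z :=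
      (hF.comp (by fun_prop)).indicator hC
    have e : ∀ w, {p : ℝ × W | p.1 ∈ I ∧ p.1⁻¹ • p.2 ∈ C}.indicator F (t, w) =
        C.indicator (fun z => F (t, t • z)) (t⁻¹ • w) := by
      intro w
      by_cases hw : t⁻¹ • w ∈ C <;> simp [hw, ht, smul_smul, ht0.ne']
    rw [lintegral_congr e, ← lintegral_map hH (measurable_const_smul t⁻¹),
      Measure.map_addHaar_smul μ (inv_ne_zero ht0.ne'), lintegral_smul_measure,
      lintegral_indicator hC, smul_eq_mul]
    congr 2
    rw [inv_pow, inv_inv, abs_of_pos (by positivity)]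
  · simp [ht]

/-- The joint density of independent exponential variables is `exp (-∑ i, X i)`. -/
lemma lintegral_pi_expo {n : ℕ} {F : (Fin n → ℝ) → ℝ≥0∞} (hF : Measurable F) :
    ∫⁻ X, F X ∂(Measure.pi fun _ => expo) =
      ∫⁻ X in {X | ∀ j, 0 < X j}, ENNReal.ofReal (Real.exp (-∑ i, X i)) * F X := by
  induction n with
  | zero =>
    simp [volume_pi]
    rw [Measure.pi_of_empty _ 0, Measure.pi_of_empty _ 0]
  | succ n ih =>
    have hO : ∀ n : ℕ, MeasurableSet {X : Fin n → ℝ | ∀ j, 0 < X j} := fun n => by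
      simp only [Set.ofPred_forall]
      exact MeasurableSet.iInter fun j => measurableSet_lt measurable_const (measurable_pi_apply j)
    have hm : Measurable fun X : Fin (n + 1) → ℝ =>
      ENNReal.ofReal (Real.exp (-∑ i, X i)) * F X := by fun_prop
    have hc := measurable_cons (n := n)
    rw [lintegral_pi_cons expo hF, ← lintegral_indicator (hO _), volume_pi,
      lintegral_pi_cons volume (hm.indicator (hO _)),
      lintegral_prod _ (by exact (hF.comp hc).aemeasurable),
      lintegral_prod _ (by exact ((hm.indicator (hO _)).comp hc).aemeasurable),
      lintegral_expo (by exact (hF.comp hc).lintegral_prod_right'), ← lintegral_indicator measurableSet_Ioi]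
    refine lintegral_congr fun t => ?_
    by_cases ht : 0 < t
    · rw [Set.indicator_of_mem (Set.mem_Ioi.2 ht), ih (by exact hF.comp (hc.comp measurable_prodMk_left)),
        ← lintegral_const_mul' _ _ ENNReal.ofReal_ne_top, ← lintegral_indicator (hO _), volume_pi]
      refine lintegral_congr fun z => ?_
      by_cases hz : ∀ j, 0 < z j
      · rw [Set.indicator_of_mem (by exact hz), Set.indicator_of_mem]
        · rw [← mul_assoc, ← ENNReal.ofReal_mul (Real.exp_nonneg _), ← Real.exp_add,
            Fin.sum_univ_succ]
          simp [add_comm]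
        · intro j
          refine Fin.cases ?_ (fun j => ?_) j <;> simp [ht, hz]
      · rw [Set.indicator_of_notMem (by exact hz), Set.indicator_of_notMem]
        intro h
        exact hz fun j => by simpa using h j.succ
    · rw [Set.indicator_of_notMem (by simpa using ht)]
      refine (lintegral_eq_zero_of_ae_eq_zero (ae_of_all _ fun z => ?_)).symm
      refine Set.indicator_of_notMem (fun h => ht ?_) _
      simpa using h 0

variable {d : ℕ}

/-- The linear map which sends the weights `X` to the total weight and the weighted sum of the
vertices `b i`. -/
def weightMap (b : AffineBasis (Fin (d + 1)) ℝ (Euc d)) : (Fin (d + 1) → ℝ) →ₗ[ℝ] ℝ × Euc d where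
  toFun X := (∑ i, X i, ∑ i, X i • b i)
  map_add' X Y := by simp [Finset.sum_add_distrib, add_smul]
  map_smul' c X := by simp [Finset.mul_sum, Finset.smul_sum, mul_smul]

lemma weightMap_injective (b : AffineBasis (Fin (d + 1)) ℝ (Euc d)) :
    Function.Injective (weightMap b) := by
  rw [← LinearMap.ker_eq_bot, LinearMap.ker_eq_bot']
  intro X hX
  have h1 : ∑ i, X i = 0 := congrArg Prod.fst hX
  have h2 : ∑ i, X i • b i = 0 := congrArg Prod.snd hX
  funext i
  exact affineIndependent_iff.1 b.ind Finset.univ X h1 h2 i (Finset.mem_univ i)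

/-- `weightMap` as a continuous linear equivalence. -/
def weightEquiv (b : AffineBasis (Fin (d + 1)) ℝ (Euc d)) : (Fin (d + 1) → ℝ) ≃L[ℝ] ℝ × Euc d :=
  (LinearEquiv.ofInjectiveOfFinrankEq (weightMap b) (weightMap_injective b)
    (by simp [add_comm])).toContinuousLinearEquiv

lemma weightEquiv_apply (b : AffineBasis (Fin (d + 1)) ℝ (Euc d)) (X : Fin (d + 1) → ℝ) :
    weightEquiv b X = (∑ i, X i, ∑ i, X i • b i) := rfl

/-- The cone over the open simplex, at height equal to the total weight, is the image of the
positive orthant under `weightMap`. -/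
lemma pos_weights_iff (b : AffineBasis (Fin (d + 1)) ℝ (Euc d)) (X : Fin (d + 1) → ℝ) :
    (∀ j, 0 < X j) ↔ 0 < ∑ i, X i ∧
      (∑ i, X i)⁻¹ • ∑ i, X i • b i ∈ interior (convexHull ℝ (Set.range b)) := by
  rw [b.interior_convexHull]
  have key : 0 < ∑ i, X i → ∀ i, b.coord i ((∑ i, X i)⁻¹ • ∑ i, X i • b i) = (∑ i, X i)⁻¹ * X i := by
    intro hS i
    have hw : ∑ i, (∑ i, X i)⁻¹ * X i = 1 := by
      rw [← Finset.mul_sum, inv_mul_cancel₀ hS.ne']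
    have : (∑ i, X i)⁻¹ • ∑ i, X i • b i =
        Finset.univ.affineCombination ℝ b fun i => (∑ i, X i)⁻¹ * X i := by
      rw [Finset.affineCombination_eq_linear_combination _ _ _ hw, Finset.smul_sum]
      simp only [mul_smul]
    rw [this, b.coord_apply_combination_of_mem (Finset.mem_univ i) hw]
  constructor
  · intro h
    have hS : 0 < ∑ i, X i := Finset.sum_pos (fun i _ => h i) Finset.univ_nonempty
    refine ⟨hS, fun i => ?_⟩
    rw [key hS]
    exact mul_pos (inv_pos.2 hS) (h i)
  · rintro ⟨hS, h⟩ i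
    have := h i
    rw [key hS] at this
    exact (pos_iff_pos_of_mul_pos this).1 (inv_pos.2 hS)

/-- The law of the total weight of `d + 1` independent exponential weights (a Gamma distribution),
up to a constant factor. -/
def radial (d : ℕ) : Measure ℝ :=
  (volume.restrict (Set.Ioi 0)).withDensity fun t => ENNReal.ofReal (t ^ d * Real.exp (-t))

instance : SFinite (radial d) := by unfold radial; infer_instance

/-- If the vertices of a simplex carry independent exponential weights, then the center of mass is
uniformly distributed in the simplex, and independent of the total weight. The constant `c` is
determined by the total mass, but its value is not needed. -/
theorem map_pi_expo (b : AffineBasis (Fin (d + 1)) ℝ (Euc d)) :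
    ∃ c : ℝ≥0∞, c ≠ ⊤ ∧ Measure.map (fun X : Fin (d + 1) → ℝ =>
        (∑ i, X i, (∑ i, X i)⁻¹ • ∑ i, X i • b i)) (Measure.pi fun _ => expo) =
      c • (radial d).prod (volume.restrict (interior (convexHull ℝ (Set.range b)))) := by
  set C := interior (convexHull ℝ (Set.range b)) with hCdef
  have hC : MeasurableSet C := isOpen_interior.measurableSet
  have : (Measure.map (weightEquiv b) volume).IsAddHaarMeasure :=
    ContinuousLinearEquiv.isAddHaarMeasure_map _ _
  have hL := Measure.isAddLeftInvariant_eq_smul (Measure.map (weightEquiv b) volume)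
    (volume.prod volume)
  set c := Measure.addHaarScalarFactor (Measure.map (weightEquiv b) volume)
    ((volume : Measure ℝ).prod (volume : Measure (Euc d)))
  have hT : Measurable fun X : Fin (d + 1) → ℝ => (∑ i, X i, (∑ i, X i)⁻¹ • ∑ i, X i • b i) := by
    fun_prop
  refine ⟨c, ENNReal.coe_ne_top, Measure.ext_of_lintegral _ fun F hF => ?_⟩
  have hF' : Measurable fun p : ℝ × Euc d => ENNReal.ofReal (Real.exp (-p.1)) * F (p.1, p.1⁻¹ • p.2) := by
    fun_prop
  have hD : MeasurableSet {p : ℝ × Euc d | p.1 ∈ Set.Ioi (0 : ℝ) ∧ p.1⁻¹ • p.2 ∈ C} :=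
    (measurable_fst measurableSet_Ioi).inter ((measurable_fst.inv.smul measurable_snd) hC)
  have hset : {X : Fin (d + 1) → ℝ | ∀ j, 0 < X j} =
      weightEquiv b ⁻¹' {p : ℝ × Euc d | p.1 ∈ Set.Ioi (0 : ℝ) ∧ p.1⁻¹ • p.2 ∈ C} := by
    ext X
    exact pos_weights_iff b X
  -- in the coordinates `weightEquiv b`, the orthant is a cone, to which `lintegral_cone` applies
  rw [lintegral_map hF hT, lintegral_pi_expo (by exact hF.comp hT), hset]
  have e1 := setLIntegral_map hD hF' (weightEquiv b).continuous.measurable (μ := volume)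
  simp only [weightEquiv_apply] at e1
  rw [← e1, hL, Measure.restrict_smul, lintegral_smul_measure,
    lintegral_cone volume measurableSet_Ioi subset_rfl hC hF', lintegral_smul_measure,
    lintegral_prod _ hF.aemeasurable, radial,
    lintegral_withDensity_eq_lintegral_mul _ (by fun_prop) hF.lintegral_prod_right']
  congr 1
  refine setLIntegral_congr_fun measurableSet_Ioi fun t ht => ?_
  have ht0 : (0 : ℝ) < t := ht
  simp only [Pi.mul_apply, finrank_euclideanSpace, Fintype.card_fin, smul_smul]
  rw [inv_mul_cancel₀ ht0.ne', ENNReal.ofReal_mul (by positivity), mul_assoc,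
    lintegral_const_mul' _ _ ENNReal.ofReal_ne_top]
  simp

/-! ### The Poincaré inequality on a simplex -/

lemma integrableOn_pow_mul_exp_neg (n : ℕ) :
    IntegrableOn (fun t : ℝ => t ^ n * Real.exp (-t)) (Set.Ioi 0) := by
  have h := Real.GammaIntegral_convergent (s := n + 1) (by positivity)
  refine h.congr_fun (fun t _ => ?_) measurableSet_Ioi
  simp [mul_comm]

lemma integral_pow_mul_exp_neg (n : ℕ) :
    ∫ t in Set.Ioi (0 : ℝ), t ^ n * Real.exp (-t) = (n.factorial : ℝ) := by
  rw [← Real.Gamma_nat_eq_factorial, Real.Gamma_eq_integral (by positivity)]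
  refine setIntegral_congr_fun measurableSet_Ioi fun t _ => ?_
  simp [mul_comm]

lemma integrable_pow_radial (k : ℕ) : Integrable (fun t => t ^ k) (radial d) := by
  rw [radial, integrable_withDensity_iff (by fun_prop) (ae_of_all _ fun _ => ENNReal.ofReal_lt_top)]
  refine (integrableOn_pow_mul_exp_neg (d + k)).congr_fun (fun t ht => ?_) measurableSet_Ioi
  have ht0 : (0 : ℝ) < t := ht
  simp only
  rw [ENNReal.toReal_ofReal (by positivity), pow_add]
  ring

lemma integral_pow_radial (k : ℕ) : ∫ t, t ^ k ∂(radial d) = ((d + k).factorial : ℝ) := by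
  rw [radial, integral_withDensity_eq_integral_toReal_smul (by fun_prop)
    (ae_of_all _ fun _ => ENNReal.ofReal_lt_top), ← integral_pow_mul_exp_neg]
  refine setIntegral_congr_fun measurableSet_Ioi fun t ht => ?_
  have ht0 : (0 : ℝ) < t := ht
  simp only [smul_eq_mul]
  rw [ENNReal.toReal_ofReal (by positivity), pow_add]
  ring

/-- Popoviciu's inequality: the variance of a quantity which varies by at most `D` is at most
`D² / 4`. -/
lemma sum_mul_sq_le {n : ℕ} {X z : Fin (n + 1) → ℝ} (hX : ∀ i, 0 ≤ X i) {a m D : ℝ}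
    (hm : ∑ i, X i * z i = (∑ i, X i) * m) (hz : ∀ i j, z i - z j ≤ D) :
    ∑ i, X i * (a + (z i - m)) ^ 2 ≤ (∑ i, X i) * (a ^ 2 + D ^ 2 / 4) := by
  obtain ⟨p, hp⟩ := Finite.exists_max z
  obtain ⟨q, hq⟩ := Finite.exists_min z
  set c := (z p + z q) / 2 with hc
  have h1 : ∑ i, X i * (a + (z i - m)) ^ 2 =
      (∑ i, X i) * a ^ 2 + ∑ i, X i * (z i - c) ^ 2 - (∑ i, X i) * (m - c) ^ 2 := by
    have e : ∀ i, X i * (a + (z i - m)) ^ 2 = X i * a ^ 2 + X i * (z i - c) ^ 2 -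
        X i * (m - c) ^ 2 + 2 * (a - (m - c)) * (X i * z i - X i * m) := fun i => by ring
    rw [Finset.sum_congr rfl fun i _ => e i]
    simp only [Finset.sum_add_distrib, Finset.sum_sub_distrib, ← Finset.sum_mul, ← Finset.mul_sum]
    rw [hm]; ring
  have h2 : ∑ i, X i * (z i - c) ^ 2 ≤ (∑ i, X i) * (D ^ 2 / 4) := by
    rw [Finset.sum_mul]
    refine Finset.sum_le_sum fun i _ => mul_le_mul_of_nonneg_left ?_ (hX i)
    have := hz p q
    have h3 := hp i
    have h4 := hq i
    have h5 : |z i - c| ≤ D / 2 := abs_le.2 ⟨by rw [hc]; linarith, by rw [hc]; linarith⟩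
    have := sq_abs (z i - c) ▸ pow_le_pow_left₀ (abs_nonneg _) h5 2
    linarith
  have h3 : 0 ≤ (∑ i, X i) * (m - c) ^ 2 :=
    mul_nonneg (Finset.sum_nonneg fun i _ => hX i) (sq_nonneg _)
  rw [h1]; linarith

lemma isCompact_convexHull_range {ι : Type*} [Finite ι] (b : ι → Euc d) :
    IsCompact (convexHull ℝ (Set.range b)) := (Set.finite_range b).isCompact_convexHull ℝ

lemma restrict_interior_convex {s : Set (Euc d)} (hs : Convex ℝ s) :
    volume.restrict (interior s) = volume.restrict s := by
  refine Measure.restrict_congr_set ?_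
  refine (interior_ae_eq_of_null_frontier (hs.addHaar_frontier volume))

/-- The Poincaré inequality on a simplex of diameter `h`. The constant `h² / (4 (d + 1))` is
smaller than `h² / π²` if `d ≥ 2`.

The inequality `pi_expo_poincare` is applied to `g X = S φ (y)`, where `S` is the sum of the weights
`X i` and `y` is the center of mass. The factor `S` makes `g` homogeneous of degree one, which gives
the sharp factor `d + 1`: one has `∂g/∂X_i = φ(y) + ∇φ(y)·(b i - y)`, and `∑ X_i (b i - y) = 0`. -/
theorem simplex_poincare (b : AffineBasis (Fin (d + 1)) ℝ (Euc d)) {φ : Euc d → ℝ}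
    (hφ : ContDiff ℝ ∞ φ) (h0 : ∫ x in convexHull ℝ (Set.range b), φ x = 0) :
    4 * (d + 1) * ∫ x in convexHull ℝ (Set.range b), φ x ^ 2 ≤
      Metric.diam (convexHull ℝ (Set.range b)) ^ 2 *
        ∫ x in convexHull ℝ (Set.range b), ‖gradient φ x‖ ^ 2 := by
  set K := convexHull ℝ (Set.range b) with hK
  set h := Metric.diam K
  have hcomp : IsCompact K := isCompact_convexHull_range b
  obtain ⟨c, hctop, hmap⟩ := map_pi_expo b
  rw [← hK] at hmap
  have hKi : volume.restrict (interior K) = volume.restrict K :=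
    restrict_interior_convex (convex_convexHull ℝ _)
  rw [hKi] at hmap
  set ν : Measure (Fin (d + 1) → ℝ) := Measure.pi fun _ => expo with hν
  set S : (Fin (d + 1) → ℝ) → ℝ := fun X => ∑ i, X i with hS
  set y : (Fin (d + 1) → ℝ) → Euc d := fun X => (∑ i, X i)⁻¹ • ∑ i, X i • b i with hy
  have hSm : Measurable S := by fun_prop
  have hym : Measurable y := by fun_prop
  have hT : Measurable fun X => (S X, y X) := by fun_prop
  have hgc := continuous_gradient hφ
  have hfc := hφ.continuous
  -- independence of `S` and `y`
  have rint : ∀ {F₁ : ℝ → ℝ} {F₂ : Euc d → ℝ}, Continuous F₁ → Continuous F₂ →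
      ∫ X, F₁ (S X) * F₂ (y X) ∂ν = c.toReal * ((∫ t, F₁ t ∂(radial d)) * ∫ x in K, F₂ x) := by
    intro F₁ F₂ h1 h2
    have := integral_map (μ := ν) hT.aemeasurable (f := fun p : ℝ × Euc d => F₁ p.1 * F₂ p.2)
      (by fun_prop)
    rw [← this, hmap, integral_smul_measure, integral_prod_mul, smul_eq_mul]
  have iint : ∀ {F₁ : ℝ → ℝ} {F₂ : Euc d → ℝ}, Continuous F₁ → Continuous F₂ →
      Integrable F₁ (radial d) → Integrable (fun X => F₁ (S X) * F₂ (y X)) ν := by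
    intro F₁ F₂ h1 h2 h3
    have h4 : Integrable (fun p : ℝ × Euc d => F₁ p.1 * F₂ p.2) (Measure.map (fun X => (S X, y X)) ν) := by
      rw [hmap]
      exact (h3.mul_prod (h2.continuousOn.integrableOn_compact hcomp)).smul_measure hctop
    exact h4.comp_measurable hT
  have hcpos : 0 < c.toReal := by
    refine ENNReal.toReal_pos (fun h => ?_) hctop
    rw [h, zero_smul] at hmap
    have : Measure.map (fun X => (S X, y X)) ν Set.univ = 1 := by
      rw [Measure.map_apply hT MeasurableSet.univ]; simp [hν]
    rw [hmap] at this
    simp at this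
  set g : (Fin (d + 1) → ℝ) → ℝ := fun X => S X * φ (y X) with hg
  set G : Fin (d + 1) → (Fin (d + 1) → ℝ) → ℝ := fun i X =>
    φ (y X) + inner ℝ (gradient φ (y X)) (b i - y X) with hG
  have hgm : Measurable g := hSm.mul (hfc.measurable.comp hym)
  have hGm : ∀ i, Measurable (G i) := fun i => by
    have h1 := hgc.measurable
    have h2 := hfc.measurable
    fun_prop
  have hSpos : ∀ X : Fin (d + 1) → ℝ, (∀ j, 0 < X j) → 0 < S X := fun X hX =>
    Finset.sum_pos (fun i _ => hX i) Finset.univ_nonempty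
  have hd : ∀ X : Fin (d + 1) → ℝ, (∀ j, 0 < X j) → ∀ i,
      HasDerivAt (fun t => g (Function.update X i t)) (G i X) (X i) := by
    intro X hX i
    have hX0 := (hSpos X hX).ne'
    have u := fun j => hasDerivAt_pi.1 (hasDerivAt_update X i (X i)) j
    have e0 : Function.update X i (X i) = X := Function.update_eq_self i X
    have dS : HasDerivAt (fun t => S (Function.update X i t)) 1 (X i) :=
      (HasDerivAt.fun_sum fun j _ => u j).congr_deriv (by simp [Pi.single_apply])
    have dA : HasDerivAt (fun t => ∑ j, Function.update X i t j • b j) (b i) (X i) :=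
      (HasDerivAt.fun_sum fun j _ => (u j).smul_const (b j)).congr_deriv
        (by simp [Pi.single_apply])
    have dy : HasDerivAt (fun t => y (Function.update X i t)) ((S X)⁻¹ • (b i - y X)) (X i) := by
      have := (dS.fun_inv (by rw [e0]; exact hX0)).fun_smul dA
      refine this.congr_deriv ?_
      simp only [e0, hy]
      rw [smul_sub, smul_smul]
      change (S X)⁻¹ • b i + (-1 / S X ^ 2) • ∑ j, X j • b j = (S X)⁻¹ • b i - _
      rw [sub_eq_add_neg, ← neg_smul]
      congr 2
      change -1 / S X ^ 2 = -((S X)⁻¹ * (S X)⁻¹)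
      field_simp

    have dφ : HasDerivAt (fun t => φ (y (Function.update X i t)))
        (inner ℝ (gradient φ (y X)) ((S X)⁻¹ • (b i - y X))) (X i) := by
      have h1 : HasFDerivAt φ (fderiv ℝ φ (y X)) (y (Function.update X i (X i))) := by
        rw [e0]
        exact (hφ.differentiable (by simp) (y X)).hasFDerivAt
      refine (h1.comp_hasDerivAt (X i) dy).congr_deriv ?_
      simp [gradient]
    refine (dS.fun_mul dφ).congr_deriv ?_
    simp only [e0, hG, inner_smul_right]
    field_simp
  have hc : ∀ i, ContinuousOn (G i) {X | ∀ j, 0 < X j} := by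
    intro i
    have hyc : ContinuousOn y {X | ∀ j, 0 < X j} :=
      ContinuousOn.smul (ContinuousOn.inv₀ (by fun_prop) fun X hX => (hSpos X hX).ne')
        (by fun_prop)
    exact (hfc.comp_continuousOn hyc).add
      ((hgc.comp_continuousOn hyc).inner (continuousOn_const.sub hyc))
  have main := pi_expo_poincare hgm hGm hd hc
  rw [← hν] at main
  -- since `g` has mean value zero, the left-hand side of `main` is twice the mean value of `g²`
  have hg1 : ∫ X, g X ∂ν = 0 := by
    have := rint continuous_id hfc
    simp only [id] at this
    rw [hg, this, h0]; ring
  have ig1 : Integrable g ν := by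
    have := iint continuous_id hfc (by simpa [Function.id_def] using integrable_pow_radial (d := d) 1)
    exact this
  have hg2 : ∫ X, g X ^ 2 ∂ν = c.toReal * ((d + 2).factorial * ∫ x in K, φ x ^ 2) := by
    rw [← integral_pow_radial, ← rint (F₂ := fun x => φ x ^ 2) (continuous_pow 2) (hfc.pow 2)]
    simp only [hg, mul_pow]
  have ig2 : Integrable (fun X => g X ^ 2) ν := by
    have := iint (F₂ := fun x => φ x ^ 2) (continuous_pow 2) (hfc.pow 2) (integrable_pow_radial 2)
    simpa only [hg, mul_pow] using this
  have hL : ∫⁻ X, ∫⁻ Y, ENNReal.ofReal ((g X - g Y) ^ 2) ∂ν ∂ν =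
      ENNReal.ofReal (2 * ∫ X, g X ^ 2 ∂ν) := by
    have e1 : ∀ X, ∫⁻ Y, ENNReal.ofReal ((g X - g Y) ^ 2) ∂ν =
        ENNReal.ofReal (g X ^ 2 + ∫ Y, g Y ^ 2 ∂ν) := by
      intro X
      have e2 : (fun Y => (g X - g Y) ^ 2) = fun Y => g X ^ 2 - 2 * g X * g Y + g Y ^ 2 := by
        funext Y; ring
      have i1 : Integrable (fun Y => g X ^ 2 - 2 * g X * g Y) ν :=
        (integrable_const _).sub (ig1.const_mul _)
      have i2 : Integrable (fun Y => (g X - g Y) ^ 2) ν := e2 ▸ i1.add ig2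
      rw [← ofReal_integral_eq_lintegral_ofReal i2 (ae_of_all _ fun Y => sq_nonneg _), e2,
        integral_add i1 ig2, integral_sub (integrable_const _) (ig1.const_mul _),
        integral_const_mul, hg1]
      simp
    rw [lintegral_congr e1, ← ofReal_integral_eq_lintegral_ofReal
      (by exact ig2.add (integrable_const _))
      (ae_of_all _ fun X => add_nonneg (sq_nonneg _) (integral_nonneg fun Y => sq_nonneg _)),
      integral_add ig2 (integrable_const _)]
    simp [two_mul]
  -- the right-hand side of `main` is bounded pointwise by Popoviciu's inequality
  set ψ : Euc d → ℝ := fun x => φ x ^ 2 + (‖gradient φ x‖ * h) ^ 2 / 4 with hψ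
  have hψc : Continuous ψ := by fun_prop
  have hR : ∑ i, ∫⁻ X, ENNReal.ofReal (X i * G i X ^ 2) ∂ν ≤
      ENNReal.ofReal (∫ X, S X * ψ (y X) ∂ν) := by
    rw [← lintegral_finsetSum _ (fun i _ => by have := hGm i; fun_prop),
      ofReal_integral_eq_lintegral_ofReal]
    · refine lintegral_mono_ae (ae_pi_expo_pos.mono fun X hX => ?_)
      rw [← ENNReal.ofReal_sum_of_nonneg fun i _ => mul_nonneg (hX i).le (sq_nonneg _)]
      refine ENNReal.ofReal_le_ofReal ?_
      have hyX : S X • y X = ∑ i, X i • b i := by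
        simp only [hy]
        rw [smul_smul, mul_inv_cancel₀ (hSpos X hX).ne', one_smul]
      have := sum_mul_sq_le (a := φ (y X)) (m := inner ℝ (gradient φ (y X)) (y X))
        (z := fun i => inner ℝ (gradient φ (y X)) (b i)) (D := ‖gradient φ (y X)‖ * h)
        (fun i => (hX i).le) ?_ ?_
      · simpa only [hG, inner_sub_right] using this
      · rw [← inner_smul_right, hyX, inner_sum]
        simp only [inner_smul_right]
      · intro i j
        rw [← inner_sub_right]
        refine (real_inner_le_norm _ _).trans (mul_le_mul_of_nonneg_left ?_ (norm_nonneg _))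
        rw [← dist_eq_norm]
        exact Metric.dist_le_diam_of_mem hcomp.isBounded
          (subset_convexHull ℝ _ (Set.mem_range_self i)) (subset_convexHull ℝ _ (Set.mem_range_self j))
    · exact iint continuous_id hψc (by simpa [Function.id_def] using integrable_pow_radial (d := d) 1)
    · exact ae_pi_expo_pos.mono fun X hX => mul_nonneg (hSpos X hX).le (by positivity)
  have hRv : ∫ X, S X * ψ (y X) ∂ν = c.toReal * ((d + 1).factorial * ∫ x in K, ψ x) := by
    have := rint continuous_id hψc
    simp only [id] at this
    rw [this, ← integral_pow_radial]
    simp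
  have fin : 2 * ∫ X, g X ^ 2 ∂ν ≤ 2 * ∫ X, S X * ψ (y X) ∂ν := by
    have h1 : ENNReal.ofReal (2 * ∫ X, g X ^ 2 ∂ν) ≤
        ENNReal.ofReal (2 * ∫ X, S X * ψ (y X) ∂ν) := by
      rw [← hL]
      refine main.trans ?_
      rw [ENNReal.ofReal_mul (by norm_num), ENNReal.ofReal_ofNat]
      gcongr
    refine (ENNReal.ofReal_le_ofReal_iff ?_).1 h1
    rw [hRv]
    have : 0 ≤ ∫ x in K, ψ x := integral_nonneg fun x => by positivity
    positivity
  have hψi : ∫ x in K, ψ x = (∫ x in K, φ x ^ 2) + h ^ 2 / 4 * ∫ x in K, ‖gradient φ x‖ ^ 2 := by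
    rw [← integral_const_mul, ← integral_add]
    · refine integral_congr_ae (ae_of_all _ fun x => ?_)
      simp only [hψ]; ring
    · exact (hfc.pow 2).continuousOn.integrableOn_compact hcomp
    · exact (continuous_const.mul (hgc.norm.pow 2)).continuousOn.integrableOn_compact hcomp
  -- the factor `(d + 2)! / (d + 1)! = d + 2` on the left exceeds the coefficient of `φ²` on the
  -- right by `d + 1`
  rw [hg2, hRv, hψi, Nat.factorial_succ (d + 1)] at fin
  push_cast at fin
  have hf : (0 : ℝ) < c.toReal * (d + 1).factorial := by positivity
  have : c.toReal * (d + 1).factorial * (4 * (d + 1) * ∫ x in K, φ x ^ 2) ≤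
      c.toReal * (d + 1).factorial * (h ^ 2 * ∫ x in K, ‖gradient φ x‖ ^ 2) := by
    linear_combination 2 * fin
  exact le_of_mul_le_mul_left this hf

/-! ### The surface measure on facets, and cones over facets -/

lemma isCompact_hull (s : Finset (Euc d)) : IsCompact (hull s) :=
  s.finite_toSet.isCompact_convexHull ℝ

lemma affineIndependent_of_subset {s t : Finset (Euc d)} (ht : AffineIndependent ℝ ((↑) : t → Euc d))
    (hst : s ⊆ t) : AffineIndependent ℝ ((↑) : s → Euc d) :=
  AffineIndependent.mono (s := (s : Set (Euc d))) (t := (t : Set (Euc d))) ht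
    (by exact_mod_cast hst)

/-- A vertex of a simplex is not in the affine hull of other vertices. -/
lemma notMem_affineSpan {s t : Finset (Euc d)} (ht : AffineIndependent ℝ ((↑) : t → Euc d))
    (hst : s ⊆ t) {a : Euc d} (hat : a ∈ t) (has : a ∉ s) :
    a ∉ affineSpan ℝ (s : Set (Euc d)) := by
  have := ht.mem_affineSpan_iff ⟨a, hat⟩ {x | (x : Euc d) ∈ s}
  have e : ((↑) : t → Euc d) '' {x | (x : Euc d) ∈ s} = s := by
    ext x
    simp only [Set.mem_image, Set.mem_ofPred_eq, Subtype.exists, Finset.mem_coe]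
    constructor
    · rintro ⟨a, _, h1, rfl⟩; exact h1
    · exact fun h1 => ⟨x, hst h1, h1, rfl⟩
  rw [e] at this
  exact fun h => has (this.1 h)

/-- An isometric parametrization of the hyperplane spanned by a facet. -/
lemma exists_facet_chart {n : ℕ} {γ : Finset (Euc (n + 1))} (hγ : γ.card = n + 1)
    (hi : AffineIndependent ℝ ((↑) : γ → Euc (n + 1))) :
    ∃ (p : Euc (n + 1)) (ψ : Euc n →ₗᵢ[ℝ] Euc (n + 1)), p ∈ γ ∧
      LinearMap.range ψ.toLinearMap = vectorSpan ℝ (γ : Set (Euc (n + 1))) := by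
  obtain ⟨p, hp⟩ : γ.Nonempty := Finset.card_pos.1 (by omega)
  have hr : Module.finrank ℝ (vectorSpan ℝ (γ : Set (Euc (n + 1)))) = n := by
    have := hi.finrank_vectorSpan (n := n) (by simpa using hγ)
    have e : Set.range ((↑) : γ → Euc (n + 1)) = (γ : Set (Euc (n + 1))) := Subtype.range_coe
    exact (LinearEquiv.ofEq _ _ (congrArg (vectorSpan ℝ) e.symm)).finrank_eq.trans this
  let e := (stdOrthonormalBasis ℝ (vectorSpan ℝ (γ : Set (Euc (n + 1))))).reindex (finCongr hr)
  refine ⟨p, (Submodule.subtypeₗᵢ _).comp e.repr.symm.toLinearIsometry, hp, ?_⟩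
  ext x
  constructor
  · rintro ⟨z, rfl⟩
    exact (e.repr.symm z).2
  · intro hx
    refine ⟨e.repr ⟨x, hx⟩, ?_⟩
    simp

section chart

variable {n : ℕ} {γ : Finset (Euc (n + 1))} {p : Euc (n + 1)} {ψ : Euc n →ₗᵢ[ℝ] Euc (n + 1)}

lemma isometry_chart (p : Euc (n + 1)) (ψ : Euc n →ₗᵢ[ℝ] Euc (n + 1)) :
    Isometry fun z => p + ψ z := (IsometryEquiv.addLeft p).isometry.comp ψ.isometry

lemma mem_range_chart (hp : p ∈ γ)
    (hψ : LinearMap.range ψ.toLinearMap = vectorSpan ℝ (γ : Set (Euc (n + 1)))) {x : Euc (n + 1)} :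
    x ∈ Set.range (fun z => p + ψ z) ↔ x ∈ affineSpan ℝ (γ : Set (Euc (n + 1))) := by
  have hpa : p ∈ affineSpan ℝ (γ : Set (Euc (n + 1))) := mem_affineSpan ℝ hp
  have : x ∈ affineSpan ℝ (γ : Set (Euc (n + 1))) ↔
      x - p ∈ LinearMap.range ψ.toLinearMap := by
    rw [hψ, ← direction_affineSpan]
    exact (AffineSubspace.vsub_right_mem_direction_iff_mem hpa x).symm
  rw [this]
  constructor
  · rintro ⟨z, rfl⟩
    exact ⟨z, by simp⟩
  · rintro ⟨z, hz⟩
    refine ⟨z, ?_⟩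
    have hz' : ψ z = x - p := hz
    simp [hz']

lemma hull_subset_range_chart (hp : p ∈ γ)
    (hψ : LinearMap.range ψ.toLinearMap = vectorSpan ℝ (γ : Set (Euc (n + 1)))) :
    hull γ ⊆ Set.range (fun z => p + ψ z) := fun _ hx =>
  (mem_range_chart hp hψ).2 (convexHull_subset_affineSpan _ hx)

/-- In the chart, the surface measure is the Lebesgue measure. -/
lemma surf_restrict_eq_map (hp : p ∈ γ)
    (hψ : LinearMap.range ψ.toLinearMap = vectorSpan ℝ (γ : Set (Euc (n + 1))))
    {s : Set (Euc (n + 1))} (hs : MeasurableSet s) (hsγ : s ⊆ hull γ) :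
    (surf (n + 1)).restrict s =
      Measure.map (fun z => p + ψ z) (volume.restrict ((fun z => p + ψ z) ⁻¹' s)) := by
  have hj := isometry_chart p ψ
  have h1 : Measure.map (fun z => p + ψ z) volume =
      (surf (n + 1)).restrict (Set.range fun z => p + ψ z) := by
    rw [← EuclideanSpace.euclideanHausdorffMeasure_eq_volume]
    exact hj.map_euclideanHausdorffMeasure
  rw [← Measure.restrict_map hj.continuous.measurable hs, h1, Measure.restrict_restrict hs,
    Set.inter_eq_left.2 (hsγ.trans (hull_subset_range_chart hp hψ))]

lemma surf_hull_lt_top (hγ : γ.card = n + 1) (hi : AffineIndependent ℝ ((↑) : γ → Euc (n + 1))) :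
    surf (n + 1) (hull γ) < ⊤ := by
  obtain ⟨p, ψ, hp, hψ⟩ := exists_facet_chart hγ hi
  have h := surf_restrict_eq_map hp hψ (isCompact_hull γ).measurableSet subset_rfl
  have hj := isometry_chart p ψ
  have hc : IsCompact ((fun z => p + ψ z) ⁻¹' hull γ) :=
    hj.isClosedEmbedding.isCompact_preimage (isCompact_hull γ)
  rw [← Measure.restrict_apply_univ, h, Measure.map_apply hj.continuous.measurable MeasurableSet.univ]
  simpa using hc.measure_lt_top

/-- The hull of a proper subset of the vertices of a facet has no surface measure. -/
lemma surf_hull_eq_zero (hγ : γ.card = n + 1) (hi : AffineIndependent ℝ ((↑) : γ → Euc (n + 1)))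
    {s : Finset (Euc (n + 1))} (hs : s ⊂ γ) : surf (n + 1) (hull s) = 0 := by
  obtain ⟨p, ψ, hp, hψ⟩ := exists_facet_chart hγ hi
  have hj := isometry_chart p ψ
  have hsub : hull s ⊆ hull γ := convexHull_mono (by exact_mod_cast hs.subset)
  have h := surf_restrict_eq_map hp hψ (isCompact_hull s).measurableSet hsub
  rw [← Measure.restrict_apply_univ, h, Measure.map_apply hj.continuous.measurable MeasurableSet.univ,
    Set.preimage_univ, Measure.restrict_apply_univ]
  let J : Euc n →ᵃ[ℝ] Euc (n + 1) :=
    (AffineEquiv.constVAdd ℝ (Euc (n + 1)) p).toAffineMap.comp ψ.toLinearMap.toAffineMap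
  have hJ : ∀ z, J z = p + ψ z := fun z => rfl
  refine measure_mono_null (t := ((affineSpan ℝ (s : Set (Euc (n + 1)))).comap J : Set (Euc n))) ?_
    (Measure.addHaar_affineSubspace _ _ ?_)
  · intro z hz
    exact convexHull_subset_affineSpan _ hz
  · intro htop
    obtain ⟨q, hqγ, hqs⟩ := Finset.exists_of_ssubset hs
    obtain ⟨z, hz⟩ := (mem_range_chart hp hψ).2 (mem_affineSpan ℝ (Finset.mem_coe.2 hqγ))
    have hz' : z ∈ (affineSpan ℝ (s : Set (Euc (n + 1)))).comap J := by
      rw [htop]; trivial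
    have hq : q ∈ affineSpan ℝ (s : Set (Euc (n + 1))) := by
      rw [← hz]; exact hz'
    exact notMem_affineSpan hi hs.subset hqγ hqs hq

end chart

/-- The linear map `(t, w) ↦ t q + ψ w`. -/
def coneMap {n : ℕ} (q : Euc (n + 1)) (ψ : Euc n →ₗᵢ[ℝ] Euc (n + 1)) :
    ℝ × Euc n →ₗ[ℝ] Euc (n + 1) :=
  (LinearMap.toSpanSingleton ℝ _ q).coprod ψ.toLinearMap

lemma coneMap_apply {n : ℕ} (q : Euc (n + 1)) (ψ : Euc n →ₗᵢ[ℝ] Euc (n + 1)) (x : ℝ × Euc n) :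
    coneMap q ψ x = x.1 • q + ψ x.2 := rfl

/-- Integration over a simplex, as a cone with apex `a` over the opposite facet `γ`: the
section at relative height `t` is a copy of `γ`, scaled by `t`. -/
theorem exists_restrict_hull_eq_map {n : ℕ} {γ : Finset (Euc (n + 1))} {a : Euc (n + 1)}
    (hγ : γ.card = n + 1) (hi : AffineIndependent ℝ ((↑) : γ → Euc (n + 1)))
    (ha : a ∉ affineSpan ℝ (γ : Set (Euc (n + 1)))) :
    ∃ c : ℝ≥0∞, c ≠ ⊤ ∧ volume.restrict (convexHull ℝ (insert a (γ : Set (Euc (n + 1))))) =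
      Measure.map (fun x : ℝ × Euc (n + 1) => a + x.1 • (x.2 - a))
        (c • ((volume.restrict (Set.Ioc 0 1)).withDensity fun t => ENNReal.ofReal (t ^ n)).prod
          ((surf (n + 1)).restrict (hull γ))) := by
  obtain ⟨p, ψ, hp, hψ⟩ := exists_facet_chart hγ hi
  set K := convexHull ℝ (insert a (γ : Set (Euc (n + 1)))) with hK
  have hj := isometry_chart p ψ
  have hjm := hj.continuous.measurable
  set C := (fun z => p + ψ z) ⁻¹' hull γ with hCdef
  have hC : MeasurableSet C := hjm (isCompact_hull γ).measurableSet
  have hKm : MeasurableSet K :=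
    ((γ.finite_toSet.insert a).isCompact_convexHull ℝ).measurableSet
  have hinj : Function.Injective (coneMap (p - a) ψ) := by
    rw [← LinearMap.ker_eq_bot, LinearMap.ker_eq_bot']
    rintro ⟨t, w⟩ h
    rw [coneMap_apply] at h
    simp only at h
    have ht : t = 0 := by
      by_contra ht
      refine ha ((mem_range_chart hp hψ).1 ⟨t⁻¹ • w, ?_⟩)
      have h2 : t⁻¹ • (t • (p - a) + ψ w) = 0 := by rw [h, smul_zero]
      rw [smul_add, smul_smul, inv_mul_cancel₀ ht, one_smul] at h2
      simp only [map_smul]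
      have : p + t⁻¹ • ψ w - a = 0 := by rw [← h2]; abel
      exact sub_eq_zero.1 this
    subst ht
    rw [zero_smul, zero_add] at h
    rw [(map_eq_zero_iff ψ ψ.injective).1 h]
    rfl
  let L : (ℝ × Euc n) ≃L[ℝ] Euc (n + 1) :=
    (LinearEquiv.ofInjectiveOfFinrankEq (coneMap (p - a) ψ) hinj
      (by simp [add_comm])).toContinuousLinearEquiv
  have hLa : ∀ t w, L (t, w) = t • (p - a) + ψ w := fun t w => rfl
  have hLa' : ∀ t z, a + L (t, t • z) = a + t • (p + ψ z - a) := by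
    intro t z
    rw [hLa, map_smul, ← smul_add]
    congr 2; abel
  have : (volume : Measure (ℝ × Euc n)).IsAddHaarMeasure :=
    inferInstanceAs (Measure.prod volume volume).IsAddHaarMeasure
  have : (Measure.map L volume).IsAddHaarMeasure := ContinuousLinearEquiv.isAddHaarMeasure_map _ _
  have hLm := Measure.isAddLeftInvariant_eq_smul (volume : Measure (Euc (n + 1)))
    (Measure.map L volume)
  set c := Measure.addHaarScalarFactor (volume : Measure (Euc (n + 1))) (Measure.map L volume)
  -- the slice `t = 0` has to be excluded: there `t⁻¹ • w` is zero
  have hset : ∀ t w, t ≠ 0 → (a + L (t, w) ∈ K ↔ t ∈ Set.Ioc (0 : ℝ) 1 ∧ t⁻¹ • w ∈ C) := by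
    intro t w ht
    rw [hK, convexHull_insert (by exact ⟨p, hp⟩), mem_convexJoin]
    constructor
    · rintro ⟨x, rfl, y, hy, hs⟩
      obtain ⟨z, rfl⟩ := hull_subset_range_chart hp hψ hy
      rw [segment_eq_image'] at hs
      obtain ⟨s, hs1, hs2⟩ := hs
      change x + s • (p + ψ z - x) = _ at hs2
      rw [← hLa'] at hs2
      have h3 := L.injective (add_left_cancel hs2)
      obtain ⟨rfl, rfl⟩ := Prod.mk.inj h3
      refine ⟨⟨lt_of_le_of_ne hs1.1 (Ne.symm ht), hs1.2⟩, ?_⟩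
      rw [smul_smul, inv_mul_cancel₀ ht, one_smul]
      exact hy
    · rintro ⟨h1, h2⟩
      refine ⟨a, rfl, p + ψ (t⁻¹ • w), h2, ?_⟩
      rw [segment_eq_image']
      refine ⟨t, ⟨h1.1.le, h1.2⟩, ?_⟩
      change a + t • (p + ψ (t⁻¹ • w) - a) = _
      rw [← hLa', smul_smul, mul_inv_cancel₀ ht, one_smul]
  have hAm : Measurable fun x : ℝ × Euc (n + 1) => a + x.1 • (x.2 - a) := by fun_prop
  refine ⟨c, ENNReal.coe_ne_top, Measure.ext_of_lintegral _ fun F hF => ?_⟩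
  have hFL : Measurable fun x : ℝ × Euc n => F (a + L x) :=
    hF.comp (measurable_const.add L.continuous.measurable)
  have hFK := hF.indicator hKm
  have e1 : ∫⁻ x in K, F x = c * ∫⁻ x : ℝ × Euc n, K.indicator F (a + L x) := by
    rw [← lintegral_indicator hKm, ← lintegral_add_left_eq_self _ a]
    nth_rw 1 [hLm]
    rw [lintegral_smul_measure, lintegral_map (by fun_prop) L.continuous.measurable]
    rfl
  have hD : MeasurableSet {x : ℝ × Euc n | x.1 ∈ Set.Ioc (0 : ℝ) 1 ∧ x.1⁻¹ • x.2 ∈ C} :=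
    (measurable_fst measurableSet_Ioc).inter ((measurable_fst.inv.smul measurable_snd) hC)
  have e2 : ∫⁻ x : ℝ × Euc n, K.indicator F (a + L x) =
      ∫⁻ x in {x : ℝ × Euc n | x.1 ∈ Set.Ioc (0 : ℝ) 1 ∧ x.1⁻¹ • x.2 ∈ C}, F (a + L x)
        ∂(volume.prod volume) := by
    rw [← lintegral_indicator hD]
    refine lintegral_congr_ae ?_
    have h0 : ∀ᵐ x : ℝ × Euc n, x.1 ≠ 0 := by
      have : ∀ᵐ t : ℝ, t ≠ 0 := by simp [ae_iff]
      exact Measure.quasiMeasurePreserving_fst.ae this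
    filter_upwards [h0] with x hx
    obtain ⟨t, w⟩ := x
    by_cases h : a + L (t, w) ∈ K
    · rw [Set.indicator_of_mem h, Set.indicator_of_mem]
      exact (hset t w hx).1 h
    · rw [Set.indicator_of_notMem h, Set.indicator_of_notMem]
      exact fun h' => h ((hset t w hx).2 h')
  rw [e1, e2, lintegral_cone volume measurableSet_Ioc (fun t ht => ht.1) hC hFL,
    lintegral_map hF hAm, lintegral_smul_measure,
    surf_restrict_eq_map hp hψ (isCompact_hull γ).measurableSet subset_rfl, ← hCdef]
  have hFA : Measurable fun x : ℝ × Euc (n + 1) => F (a + x.1 • (x.2 - a)) := hF.comp hAm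
  rw [lintegral_prod _ hFA.aemeasurable, lintegral_withDensity_eq_lintegral_mul _ (by fun_prop)
    hFA.lintegral_prod_right', smul_eq_mul]
  congr 1
  refine lintegral_congr fun t => ?_
  simp only [Pi.mul_apply, finrank_euclideanSpace, Fintype.card_fin]
  rw [lintegral_map (by fun_prop) hjm]
  simp only [hLa']

/-! ### `L²` norms and the trace identity -/

section L2

variable {F : Type*} [NormedAddCommGroup F] {μ : Measure (Euc d)}

lemma l2norm_nonneg (μ : Measure (Euc d)) (g : Euc d → F) : 0 ≤ l2norm μ g := Real.sqrt_nonneg _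

lemma l2norm_sq (μ : Measure (Euc d)) (g : Euc d → F) : l2norm μ g ^ 2 = ∫ x, ‖g x‖ ^ 2 ∂μ :=
  Real.sq_sqrt (integral_nonneg fun _ => by positivity)

lemma l2norm_eq_norm_toLp {g : Euc d → F} (hg : MemLp g 2 μ) : l2norm μ g = ‖hg.toLp g‖ := by
  rw [Lp.norm_toLp, hg.eLpNorm_eq_integral_rpow_norm (by simp) (by simp), ENNReal.toReal_ofReal
    (by positivity), l2norm, Real.sqrt_eq_rpow]
  simp

lemma tendsto_l2norm {f : ℕ → Euc d → F} {g : Euc d → F} (hf : ∀ n, MemLp (f n) 2 μ)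
    (hg : MemLp g 2 μ) (h : Tendsto (fun n => eLpNorm (f n - g) 2 μ) atTop (𝓝 0)) :
    Tendsto (fun n => l2norm μ (f n)) atTop (𝓝 (l2norm μ g)) := by
  simp only [l2norm_eq_norm_toLp (hf _), l2norm_eq_norm_toLp hg]
  refine Tendsto.norm ?_
  rw [Lp.tendsto_Lp_iff_tendsto_eLpNorm'']
  exact h

lemma integral_inner_le [InnerProductSpace ℝ F] {f g : Euc d → F} (hf : MemLp f 2 μ)
    (hg : MemLp g 2 μ) : ∫ x, inner ℝ (f x) (g x) ∂μ ≤ l2norm μ f * l2norm μ g := by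
  rw [l2norm_eq_norm_toLp hf, l2norm_eq_norm_toLp hg]
  refine le_trans (le_of_eq ?_) (real_inner_le_norm (hf.toLp f) (hg.toLp g))
  rw [L2.inner_def]
  refine integral_congr_ae ?_
  filter_upwards [hf.coeFn_toLp, hg.coeFn_toLp] with x h1 h2
  rw [h1, h2]

lemma integrable_inner [InnerProductSpace ℝ F] {f g : Euc d → F} (hf : MemLp f 2 μ)
    (hg : MemLp g 2 μ) : Integrable (fun x => inner ℝ (f x) (g x)) μ := by
  refine (L2.integrable_inner (𝕜 := ℝ) (hf.toLp f) (hg.toLp g)).congr ?_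
  filter_upwards [hf.coeFn_toLp, hg.coeFn_toLp] with x h1 h2
  rw [h1, h2]

lemma integral_mul_le {f g : Euc d → ℝ} (hf : MemLp f 2 μ) (hg : MemLp g 2 μ) :
    ∫ x, f x * g x ∂μ ≤ l2norm μ f * l2norm μ g := by
  have := integral_inner_le hg hf
  rw [mul_comm] at this
  simpa using this

lemma integrable_mul {f g : Euc d → ℝ} (hf : MemLp f 2 μ) (hg : MemLp g 2 μ) :
    Integrable (fun x => f x * g x) μ := by
  have := integrable_inner hg hf
  simpa using this

lemma memLp_restrict_of_continuous {f : Euc d → F} [SecondCountableTopologyEither (Euc d) F]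
    (hf : Continuous f) {s : Set (Euc d)} (hs : IsCompact s) (h : μ s < ⊤) :
    MemLp f 2 (μ.restrict s) := by
  obtain ⟨C, hC⟩ := hs.exists_bound_of_continuousOn hf.continuousOn
  have : IsFiniteMeasure (μ.restrict s) := ⟨by simpa using h⟩
  exact MemLp.of_bound hf.aestronglyMeasurable C
    (ae_restrict_of_forall_mem hs.measurableSet hC)

end L2

/-- Integrating `div ((x - a) φ²)` over the simplex with apex `a` and opposite facet `γ` gives the
surface integral of `φ²` over `γ`. -/
theorem setIntegral_facet_sq {n : ℕ} {γ : Finset (Euc (n + 1))} {a : Euc (n + 1)}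
    (hγ : γ.card = n + 1) (hi : AffineIndependent ℝ ((↑) : γ → Euc (n + 1)))
    (ha : a ∉ affineSpan ℝ (γ : Set (Euc (n + 1))))
    (hK : volume (convexHull ℝ (insert a (γ : Set (Euc (n + 1))))) ≠ 0)
    {φ : Euc (n + 1) → ℝ} (hφ : ContDiff ℝ ∞ φ) :
    ∫ x in hull γ, φ x ^ 2 ∂(surf (n + 1)) =
      (surf (n + 1)).real (hull γ) /
        ((n + 1 : ℕ) * volume.real (convexHull ℝ (insert a (γ : Set (Euc (n + 1)))))) *
      ∫ x in convexHull ℝ (insert a (γ : Set (Euc (n + 1)))),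
        ((n + 1) * φ x ^ 2 + 2 * (φ x * inner ℝ (gradient φ x) (x - a))) := by
  obtain ⟨c, hc, hmap⟩ := exists_restrict_hull_eq_map hγ hi ha
  set K := convexHull ℝ (insert a (γ : Set (Euc (n + 1)))) with hKdef
  have hKc : IsCompact K := (γ.finite_toSet.insert a).isCompact_convexHull ℝ
  have hγt := surf_hull_lt_top hγ hi
  have : IsFiniteMeasure ((surf (n + 1)).restrict (hull γ)) := ⟨by simpa using hγt⟩
  set R : Measure ℝ := (volume.restrict (Set.Ioc 0 1)).withDensity fun t => ENNReal.ofReal (t ^ n)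
    with hR
  have hAm : Measurable fun x : ℝ × Euc (n + 1) => a + x.1 • (x.2 - a) := by fun_prop
  have hc0 : c ≠ 0 := by
    rintro rfl
    rw [zero_smul, Measure.map_zero, Measure.restrict_eq_zero] at hmap
    exact hK hmap
  have hcr : 0 < c.toReal := ENNReal.toReal_pos hc0 hc
  -- the cone formula for continuous functions
  have key : ∀ G : Euc (n + 1) → ℝ, Continuous G → ∫ x in K, G x =
      c.toReal * ∫ y in hull γ, (∫ t in Set.Ioc (0 : ℝ) 1, t ^ n * G (a + t • (y - a)))
        ∂(surf (n + 1)) := by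
    intro G hG
    have hint : Integrable G (volume.restrict K) := hG.continuousOn.integrableOn_compact hKc
    rw [hmap] at hint ⊢
    have hint2 := (integrable_map_measure hG.aestronglyMeasurable hAm.aemeasurable).1 hint
    rw [integrable_smul_measure hc0 hc] at hint2
    rw [integral_map hAm.aemeasurable hG.aestronglyMeasurable, integral_smul_measure,
      integral_prod_symm _ (by exact hint2), smul_eq_mul]
    congr 1
    refine integral_congr_ae (ae_of_all _ fun y => ?_)
    simp only
    rw [hR, integral_withDensity_eq_integral_toReal_smul (by fun_prop)
      (ae_of_all _ fun _ => ENNReal.ofReal_lt_top)]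
    refine setIntegral_congr_fun measurableSet_Ioc fun t ht => ?_
    simp only [smul_eq_mul]
    rw [ENNReal.toReal_ofReal (pow_nonneg ht.1.le _)]
  -- the constant is determined by the volume of the simplex
  have hvol : volume.real K = c.toReal * ((surf (n + 1)).real (hull γ) / (n + 1)) := by
    have := key (fun _ => 1) continuous_const
    have h1 : ∫ t in Set.Ioc (0 : ℝ) 1, t ^ n * 1 = 1 / (n + 1) := by
      rw [← intervalIntegral.integral_of_le zero_le_one]
      simp [integral_pow]
    rw [h1] at this
    simp only [integral_const, smul_eq_mul, mul_one] at this
    simp only [Measure.real, Measure.restrict_apply_univ] at this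
    simp only [Measure.real]
    rw [this]; ring
  have hgc := continuous_gradient hφ
  have hfc := hφ.continuous
  have hG : Continuous fun x => (n + 1) * φ x ^ 2 + 2 * (φ x * inner ℝ (gradient φ x) (x - a)) := by
    fun_prop
  -- the radial integrand is the derivative of `t ^ (n + 1) φ (a + t (y - a))²`
  have h_inner : ∀ y, ∫ t in Set.Ioc (0 : ℝ) 1, t ^ n * ((n + 1) * φ (a + t • (y - a)) ^ 2 +
      2 * (φ (a + t • (y - a)) * inner ℝ (gradient φ (a + t • (y - a))) (a + t • (y - a) - a))) =
      φ y ^ 2 := by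
    intro y
    have hd : ∀ t ∈ Set.uIcc (0 : ℝ) 1, HasDerivAt (fun t => t ^ (n + 1) * φ (a + t • (y - a)) ^ 2)
        (t ^ n * ((n + 1) * φ (a + t • (y - a)) ^ 2 + 2 * (φ (a + t • (y - a)) *
          inner ℝ (gradient φ (a + t • (y - a))) (a + t • (y - a) - a)))) t := by
      intro t _
      have d1 : HasDerivAt (fun t : ℝ => a + t • (y - a)) (y - a) t := by
        simpa using ((hasDerivAt_id t).smul_const (y - a)).const_add a
      have d2 := ((hφ.differentiable (by simp) (a + t • (y - a))).hasFDerivAt.comp_hasDerivAt t d1)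
      have d3 := (hasDerivAt_pow (n + 1) t).fun_mul (d2.fun_pow 2)
      refine d3.congr_deriv ?_
      have : inner ℝ (gradient φ (a + t • (y - a))) (a + t • (y - a) - a) =
          t * fderiv ℝ φ (a + t • (y - a)) (y - a) := by
        rw [add_sub_cancel_left, inner_smul_right]
        simp [gradient]
      rw [this]
      simp only [Function.comp]
      push_cast
      simp only [pow_one]
      ring
    rw [← intervalIntegral.integral_of_le zero_le_one,
      intervalIntegral.integral_eq_sub_of_hasDerivAt hd]
    · simp
    · refine Continuous.intervalIntegrable ?_ _ _
      have : Continuous fun t : ℝ => a + t • (y - a) := by fun_prop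
      exact (continuous_pow n).mul (hG.comp this)
  rw [key _ hG]
  simp only [h_inner]
  have hK0 : volume.real K ≠ 0 := by
    rw [Measure.real]
    exact (ENNReal.toReal_pos hK hKc.measure_lt_top.ne).ne'
  have hs0 : (surf (n + 1)).real (hull γ) ≠ 0 := fun h => hK0 (by rw [hvol, h]; simp)
  rw [hvol]
  push_cast
  have : (n + 1 : ℝ) ≠ 0 := by positivity
  field_simp

/-! ### Geometry of meshes -/

lemma volume_hull_eq_zero_of_ssubset {s t : Finset (Euc d)}
    (ht : AffineIndependent ℝ ((↑) : t → Euc d)) (hst : s ⊂ t) : volume (hull s) = 0 := by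
  obtain ⟨a, hat, has⟩ := Finset.exists_of_ssubset hst
  refine measure_mono_null (convexHull_subset_affineSpan _) (Measure.addHaar_affineSubspace _ _ ?_)
  intro h
  refine notMem_affineSpan ht hst.subset hat has ?_
  rw [h]; trivial

lemma surf_hull_lt_top' (hd : 1 ≤ d) {γ : Finset (Euc d)} (hγ : γ.card = d)
    (hi : AffineIndependent ℝ ((↑) : γ → Euc d)) : surf d (hull γ) < ⊤ := by
  obtain ⟨n, rfl⟩ := Nat.exists_eq_add_of_le' hd
  exact surf_hull_lt_top hγ hi

lemma surf_hull_eq_zero' (hd : 1 ≤ d) {γ : Finset (Euc d)} (hγ : γ.card = d)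
    (hi : AffineIndependent ℝ ((↑) : γ → Euc d)) {s : Finset (Euc d)} (hs : s ⊂ γ) :
    surf d (hull s) = 0 := by
  obtain ⟨n, rfl⟩ := Nat.exists_eq_add_of_le' hd
  exact surf_hull_eq_zero hγ hi hs

lemma setIntegral_biUnion_of_inter_null {ι F : Type*} [NormedAddCommGroup F] [NormedSpace ℝ F]
    {μ : Measure (Euc d)} {f : Euc d → F} {s : Finset ι} {A : ι → Set (Euc d)}
    (hA : ∀ i ∈ s, MeasurableSet (A i)) (hd : ∀ i ∈ s, ∀ j ∈ s, i ≠ j → μ (A i ∩ A j) = 0)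
    (hf : ∀ i ∈ s, IntegrableOn f (A i) μ) :
    ∫ x in ⋃ i ∈ s, A i, f x ∂μ = ∑ i ∈ s, ∫ x in A i, f x ∂μ := by
  classical
  induction s using Finset.induction_on with
  | empty => simp
  | insert a s ha ih =>
    simp only [Finset.mem_insert, forall_eq_or_imp] at hA hf
    have hd' : ∀ i ∈ s, μ (A a ∩ A i) = 0 := fun i hi =>
      hd a (by simp) i (by simp [hi]) (fun h => ha (h ▸ hi))
    have hdis : AEDisjoint μ (A a) (⋃ i ∈ s, A i) := by
      refine (measure_mono_null (t := ⋃ i ∈ s, A a ∩ A i) ?_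
        ((measure_biUnion_null_iff s.countable_toSet).2 hd') : μ _ = 0)
      rw [Set.inter_iUnion₂]
    rw [Finset.sum_insert ha, Finset.set_biUnion_insert, setIntegral_union₀ hdis
      (s.measurableSet_biUnion hA.2).nullMeasurableSet hf.1
      ((integrableOn_finset_iUnion).2 hf.2), ih hA.2
      (fun i hi j hj => hd i (by simp [hi]) j (by simp [hj])) hf.2]

namespace Mesh

variable {T : Mesh d} {K L γ γ' : Finset (Euc d)}

lemma exists_affineBasis (hK : K ∈ T.elements) :
    ∃ b : AffineBasis (Fin (d + 1)) ℝ (Euc d), Set.range b = (K : Set (Euc d)) := by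
  let e := K.equivFinOfCardEq (T.card_eq K hK)
  have hi : AffineIndependent ℝ (fun i => (e.symm i : Euc d)) :=
    (T.affineIndependent K hK).comp_embedding e.symm.toEmbedding
  have hs : affineSpan ℝ (Set.range fun i => (e.symm i : Euc d)) = ⊤ :=
    hi.affineSpan_eq_top_iff_card_eq_finrank_add_one.2 (by simp)
  refine ⟨⟨_, hi, hs⟩, ?_⟩
  ext x
  constructor
  · rintro ⟨i, rfl⟩
    exact (e.symm i).2
  · intro hx
    refine ⟨e ⟨x, hx⟩, ?_⟩
    change ((e.symm (e ⟨x, hx⟩) : K) : Euc d) = x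
    simp

lemma volume_hull_ne_zero (hK : K ∈ T.elements) : volume (hull K) ≠ 0 := by
  obtain ⟨b, hb⟩ := T.exists_affineBasis hK
  have h : (interior (hull K)).Nonempty := by
    unfold hull
    rw [← hb]
    exact ⟨_, b.centroid_mem_interior_convexHull⟩
  exact fun h0 => (isOpen_interior.measure_pos volume h).ne'
    (measure_mono_null interior_subset h0)

lemma hull_inter (hK : K ∈ T.elements) (hL : L ∈ T.elements) :
    hull K ∩ hull L = hull (K ∩ L) := by
  rw [T.conforming K hK L hL]
  simp [hull]

lemma volume_hull_inter (hK : K ∈ T.elements) (hL : L ∈ T.elements) (h : K ≠ L) :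
    volume (hull K ∩ hull L) = 0 := by
  rw [T.hull_inter hK hL]
  refine volume_hull_eq_zero_of_ssubset (T.affineIndependent K hK)
    (Finset.inter_subset_left.ssubset_of_ne fun h' => h ?_)
  exact Finset.eq_of_subset_of_card_le (Finset.inter_eq_left.1 h')
    (by rw [T.card_eq K hK, T.card_eq L hL])

lemma interior_hull_subset_domain (hK : K ∈ T.elements) :
    interior (hull K) ⊆ (T.domain : Set (Euc d)) :=
  interior_mono (Set.subset_biUnion_of_mem (u := fun K => hull K) hK)

lemma restrict_hull_le_vol (hK : K ∈ T.elements) : volume.restrict (hull K) ≤ vol T.domain := by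
  have : volume.restrict (hull K) = volume.restrict (interior (hull K)) :=
    (restrict_interior_convex (convex_convexHull ℝ _)).symm
  rw [this]
  exact Measure.restrict_mono (T.interior_hull_subset_domain hK) le_rfl

/-- Passing to the interior of the union of the elements changes it by a null set only. -/
lemma vol_domain (T : Mesh d) : vol T.domain = volume.restrict (⋃ K ∈ T.elements, hull K) := by
  refine Measure.restrict_congr_set (interior_subset.eventuallyLE.antisymm ?_)
  have hfr : volume (⋃ K ∈ T.elements, frontier (hull K)) = 0 := by
    refine (measure_biUnion_null_iff T.elements.countable_toSet).2 ?_
    exact fun K _ => (convex_convexHull ℝ _).addHaar_frontier volume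
  filter_upwards [measure_eq_zero_iff_ae_notMem.1 hfr] with x hx hxU
  change x ∈ ⋃ K ∈ T.elements, hull K at hxU
  obtain ⟨K, hK, hxK⟩ := Set.mem_iUnion₂.1 hxU
  refine T.interior_hull_subset_domain hK ?_
  by_contra hn
  refine hx (Set.mem_iUnion₂.2 ⟨K, hK, ?_⟩)
  exact ⟨subset_closure hxK, hn⟩

lemma integral_vol_domain {F : Type*} [NormedAddCommGroup F] [NormedSpace ℝ F] {f : Euc d → F}
    (hf : ∀ K ∈ T.elements, IntegrableOn f (hull K)) :
    ∫ x, f x ∂(vol T.domain) = ∑ K ∈ T.elements, ∫ x in hull K, f x := by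
  rw [T.vol_domain]
  exact setIntegral_biUnion_of_inter_null (fun K _ => (isCompact_hull K).measurableSet)
    (fun K hK L hL h => T.volume_hull_inter hK hL h) hf

/-- Faces of elements meet in the face spanned by their common vertices. -/
lemma hull_inter_facet {γ γ' : Finset (Euc d)} (hK : K ∈ T.elements) (hL : L ∈ T.elements)
    (hγ : γ ⊆ K) (hγ' : γ' ⊆ L) : hull γ ∩ hull γ' ⊆ hull (γ ∩ γ') := by
  have hull_inter_of : ∀ {K : Finset (Euc d)}, K ∈ T.elements → ∀ {s t : Finset (Euc d)}, s ⊆ K →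
      t ⊆ K → hull s ∩ hull t = hull (s ∩ t) := by
    intro K hK s t hs ht
    have := (T.affineIndependent K hK).convexHull_inter (s := K) hs ht
    simpa [hull] using this.symm
  rintro x ⟨h1, h2⟩
  have hxK : x ∈ hull K := convexHull_mono (by exact_mod_cast hγ) h1
  have hxL : x ∈ hull L := convexHull_mono (by exact_mod_cast hγ') h2
  have hx : x ∈ hull (K ∩ L) := T.hull_inter hK hL ▸ ⟨hxK, hxL⟩
  have h3 : x ∈ hull (γ ∩ (K ∩ L)) :=
    hull_inter_of hK hγ Finset.inter_subset_left ▸ ⟨h1, hx⟩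
  have h4 : x ∈ hull (γ' ∩ (K ∩ L)) :=
    hull_inter_of hL hγ' Finset.inter_subset_right ▸ ⟨h2, hx⟩
  have h5 : x ∈ hull (γ ∩ (K ∩ L) ∩ (γ' ∩ (K ∩ L))) :=
    hull_inter_of hK (Finset.inter_subset_right.trans Finset.inter_subset_left)
      (Finset.inter_subset_right.trans Finset.inter_subset_left) ▸ ⟨h3, h4⟩
  refine convexHull_mono ?_ h5
  intro y hy
  simp only [Finset.coe_inter, Set.mem_inter_iff, Finset.mem_coe] at hy ⊢
  exact ⟨hy.1.1, hy.2.1⟩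

lemma IsBoundaryFacet.affineIndependent (h : T.IsBoundaryFacet γ) :
    AffineIndependent ℝ ((↑) : γ → Euc d) := by
  obtain ⟨K, hK, -⟩ := h.2
  exact affineIndependent_of_subset (T.affineIndependent K hK.1) hK.2

lemma surf_hull_inter (hd : 1 ≤ d) (h : T.IsBoundaryFacet γ) (h' : T.IsBoundaryFacet γ')
    (hne : γ ≠ γ') : surf d (hull γ ∩ hull γ') = 0 := by
  obtain ⟨K, hK, -⟩ := h.2
  obtain ⟨L, hL, -⟩ := h'.2
  refine measure_mono_null (T.hull_inter_facet hK.1 hL.1 hK.2 hL.2) ?_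
  refine surf_hull_eq_zero' hd h.1 h.affineIndependent
    (Finset.inter_subset_left.ssubset_of_ne fun h0 => hne ?_)
  exact Finset.eq_of_subset_of_card_le (Finset.inter_eq_left.1 h0) (by rw [h.1, h'.1])

/-- An element is the convex hull of one of its facets and the opposite vertex. -/
lemma exists_apex (hK : K ∈ T.elements) (hγ : γ.card = d) (hγK : γ ⊆ K) :
    ∃ a, a ∈ K ∧ a ∉ affineSpan ℝ (γ : Set (Euc d)) ∧ hull K = convexHull ℝ (insert a (γ : Set (Euc d))) := by
  have hs : γ ⊂ K := hγK.ssubset_of_ne fun h => by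
    have := T.card_eq K hK
    rw [← h] at this; omega
  obtain ⟨a, haK, ha⟩ := Finset.exists_of_ssubset hs
  refine ⟨a, haK, notMem_affineSpan (T.affineIndependent K hK) hγK haK ha, ?_⟩
  have : insert a γ = K := Finset.eq_of_subset_of_card_le
    (Finset.insert_subset haK hγK) (by rw [T.card_eq K hK, Finset.card_insert_of_notMem ha, hγ])
  rw [hull, ← this]
  simp

end Mesh

namespace Problem

variable {P : Problem d}

lemma integral_ΓN (hd : 1 ≤ d) {f : Euc d → ℝ}
    (hf : ∀ γ ∈ P.neumann, IntegrableOn f (hull γ) (surf d)) :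
    ∫ x in P.ΓN, f x ∂(surf d) = ∑ γ ∈ P.neumann, ∫ x in hull γ, f x ∂(surf d) :=
  setIntegral_biUnion_of_inter_null (fun γ _ => (isCompact_hull γ).measurableSet)
    (fun γ hγ γ' hγ' h => Mesh.surf_hull_inter hd (P.neumann_bdry γ hγ) (P.neumann_bdry γ' hγ') h) hf

/-- A Neumann facet belongs to exactly one element. -/
lemma sum_neumannOf (s : Finset (Euc d) → ℝ) :
    ∑ γ ∈ P.neumann, s γ = ∑ K ∈ P.mesh.elements, ∑ γ ∈ P.neumannOf K, s γ := by
  classical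
  have h : ∀ K, ∑ γ ∈ P.neumannOf K, s γ = ∑ γ ∈ P.neumann, if γ ⊆ K then s γ else 0 := fun K => by
    unfold neumannOf
    rw [Finset.sum_filter]
  rw [Finset.sum_congr rfl fun K _ => h K, Finset.sum_comm]
  refine Finset.sum_congr rfl fun γ hγ => ?_
  obtain ⟨K, hK, hu⟩ := (P.neumann_bdry γ hγ).2
  rw [Finset.sum_eq_single K, if_pos hK.2]
  · intro L hL hne
    exact if_neg fun h => hne (hu L ⟨hL, h⟩)
  · exact fun h => absurd hK.1 h

end Problem

/-! ### Projections, and inequalities on elements -/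

lemma gradient_sub_const (φ : Euc d → ℝ) (c : ℝ) :
    gradient (fun x => φ x - c) = gradient φ := by
  ext1 x
  rw [gradient, gradient, fderiv_sub_const]

lemma memLp_affineProj {μ : Measure (Euc d)} {g : Euc d → ℝ} (hg : MemLp g 2 μ) :
    MemLp (affineProj μ g) 2 μ := by
  rw [affineProj, dif_pos hg]
  exact Lp.memLp _

/-- The projection error is orthogonal to the constants. -/
lemma integral_sub_affineProj {μ : Measure (Euc d)} [IsFiniteMeasure μ] {g : Euc d → ℝ}
    (hg : MemLp g 2 μ) : ∫ x, (g x - affineProj μ g x) ∂μ = 0 := by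
  have hone : MemLp (AffineMap.const ℝ (Euc d) (1 : ℝ)) 2 μ := memLp_const 1
  have hmem : hone.toLp _ ∈ affineSubspaceL2 μ := ⟨⟨AffineMap.const ℝ (Euc d) (1 : ℝ), hone⟩, rfl⟩
  have h := (affineSubspaceL2 μ).starProjection_inner_eq_zero (hg.toLp g) _ hmem
  rw [L2.inner_def] at h
  rw [← h, affineProj, dif_pos hg]
  refine integral_congr_ae ?_
  filter_upwards [hg.coeFn_toLp, hone.coeFn_toLp,
    Lp.coeFn_sub (hg.toLp g) ((affineSubspaceL2 μ).starProjection (hg.toLp g))] with x h1 h2 h3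
  rw [h2, h3]
  simp [h1]

section smooth

variable {T : Mesh d} {K γ : Finset (Euc d)} {φ : Euc d → ℝ}

instance (K : Finset (Euc d)) : IsFiniteMeasure (volume.restrict (hull K)) :=
  ⟨by simpa using (isCompact_hull K).measure_lt_top⟩

lemma Mesh.volume_real_hull_pos (hK : K ∈ T.elements) : 0 < volume.real (hull K) :=
  ENNReal.toReal_pos (T.volume_hull_ne_zero hK) (isCompact_hull K).measure_lt_top.ne

/-- The Poincaré inequality on an element, in a form which is continuous in `L²`. -/
lemma smooth_poincare (hK : K ∈ T.elements) (hφ : ContDiff ℝ ∞ φ) :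
    4 * (d + 1) * (l2norm (volume.restrict (hull K)) φ ^ 2 -
      (∫ x in hull K, φ x) ^ 2 / volume.real (hull K)) ≤
      Problem.h K ^ 2 * l2norm (volume.restrict (hull K)) (gradient φ) ^ 2 := by
  obtain ⟨b, hb⟩ := T.exists_affineBasis hK
  have hv := T.volume_real_hull_pos hK
  set c := (∫ x in hull K, φ x) / volume.real (hull K) with hc
  have i1 : Integrable φ (volume.restrict (hull K)) :=
    hφ.continuous.continuousOn.integrableOn_compact (isCompact_hull K)
  have i2 : Integrable (fun x => φ x ^ 2) (volume.restrict (hull K)) :=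
    (hφ.continuous.pow 2).continuousOn.integrableOn_compact (isCompact_hull K)
  have hcv : c * volume.real (hull K) = ∫ x in hull K, φ x := by
    rw [hc]; field_simp
  have h := simplex_poincare b (φ := fun x => φ x - c) (hφ.sub contDiff_const)
  rw [hb, gradient_sub_const] at h
  change (∫ x in hull K, (φ x - c) = 0) → 4 * (d + 1) * ∫ x in hull K, (φ x - c) ^ 2 ≤
    Problem.h K ^ 2 * ∫ x in hull K, ‖gradient φ x‖ ^ 2 at h
  have h0 : ∫ x in hull K, (φ x - c) = 0 := by
    rw [integral_sub i1 (integrable_const _)]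
    simp [← hcv, mul_comm]
  have h1 : ∫ x in hull K, (φ x - c) ^ 2 = (∫ x in hull K, φ x ^ 2) -
      (∫ x in hull K, φ x) ^ 2 / volume.real (hull K) := by
    have e : ∀ x, (φ x - c) ^ 2 = φ x ^ 2 - (2 * c * φ x - c ^ 2) := fun x => by ring
    simp only [e]
    have i3 := (i1.const_mul (2 * c)).sub (integrable_const (c ^ 2))
    rw [integral_sub i2 (by exact i3),
      integral_sub (i1.const_mul (2 * c)) (integrable_const _), integral_const_mul, ← hcv]
    simp
    field_simp
    ring
  rw [l2norm_sq, l2norm_sq]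
  simp only [Real.norm_eq_abs, sq_abs]
  rw [← h1]
  exact h h0

/-- The trace inequality on an element, from `setIntegral_facet_sq` and `|x - a| ≤ h_K`. -/
lemma smooth_trace (hd : 1 ≤ d) (hK : K ∈ T.elements) (hγ : γ.card = d) (hγK : γ ⊆ K)
    (hφ : ContDiff ℝ ∞ φ) :
    l2norm ((surf d).restrict (hull γ)) φ ^ 2 ≤ Problem.ratio K γ *
      (d * l2norm (volume.restrict (hull K)) φ ^ 2 +
        2 * Problem.h K * (l2norm (volume.restrict (hull K)) φ *
          l2norm (volume.restrict (hull K)) (gradient φ))) := by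
  obtain ⟨a, haK, ha, hKa⟩ := T.exists_apex hK hγ hγK
  have hi := affineIndependent_of_subset (T.affineIndependent K hK) hγK
  have hKc := isCompact_hull K
  obtain ⟨n, rfl⟩ := Nat.exists_eq_add_of_le' hd
  have hvol := T.volume_hull_ne_zero hK
  rw [hKa] at hvol
  have key := setIntegral_facet_sq hγ hi ha hvol hφ
  rw [← hKa] at key
  have hgc := continuous_gradient hφ
  have hfc := hφ.continuous
  have int : ∀ {G : Euc (n + 1) → ℝ}, Continuous G → Integrable G (volume.restrict (hull K)) :=
    fun hG => hG.continuousOn.integrableOn_compact hKc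
  have m1 : MemLp (fun x => |φ x|) 2 (volume.restrict (hull K)) :=
    memLp_restrict_of_continuous hfc.abs hKc hKc.measure_lt_top
  have m2 : MemLp (fun x => ‖gradient φ x‖) 2 (volume.restrict (hull K)) :=
    memLp_restrict_of_continuous hgc.norm hKc hKc.measure_lt_top
  have hcs := integral_mul_le m1 m2
  have e1 : l2norm (volume.restrict (hull K)) (fun x => |φ x|) =
      l2norm (volume.restrict (hull K)) φ := by simp [l2norm]
  have e2 : l2norm (volume.restrict (hull K)) (fun x => ‖gradient φ x‖) =
      l2norm (volume.restrict (hull K)) (gradient φ) := by simp [l2norm]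
  rw [e1, e2] at hcs
  have hh : 0 ≤ Problem.h K := Metric.diam_nonneg
  have hle : ∫ x in hull K, (((n : ℝ) + 1) * φ x ^ 2 +
      2 * (φ x * inner ℝ (gradient φ x) (x - a))) ≤
      ((n + 1 : ℕ) : ℝ) * l2norm (volume.restrict (hull K)) φ ^ 2 +
        2 * Problem.h K * (l2norm (volume.restrict (hull K)) φ *
          l2norm (volume.restrict (hull K)) (gradient φ)) := by
    calc ∫ x in hull K, (((n : ℝ) + 1) * φ x ^ 2 + 2 * (φ x * inner ℝ (gradient φ x) (x - a)))
        ≤ ∫ x in hull K, (((n : ℝ) + 1) * φ x ^ 2 +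
            2 * Problem.h K * (|φ x| * ‖gradient φ x‖)) := by
          refine setIntegral_mono_on (int (by fun_prop)) (int (by fun_prop)) hKc.measurableSet ?_
          intro x hx
          have hxa : ‖x - a‖ ≤ Problem.h K := by
            rw [← dist_eq_norm]
            exact Metric.dist_le_diam_of_mem hKc.isBounded hx
              (subset_convexHull ℝ _ (Finset.mem_coe.2 haK))
          have h1 : φ x * inner ℝ (gradient φ x) (x - a) ≤
              |φ x| * (‖gradient φ x‖ * Problem.h K) := by
            refine (le_abs_self _).trans ?_
            rw [abs_mul]
            refine mul_le_mul_of_nonneg_left ((abs_real_inner_le_norm _ _).trans ?_) (abs_nonneg _)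
            exact mul_le_mul_of_nonneg_left hxa (norm_nonneg _)
          linarith
      _ = ((n + 1 : ℕ) : ℝ) * l2norm (volume.restrict (hull K)) φ ^ 2 +
            2 * Problem.h K * ∫ x in hull K, |φ x| * ‖gradient φ x‖ := by
          rw [integral_add (int (by fun_prop)) (int (by fun_prop)), integral_const_mul,
            integral_const_mul, l2norm_sq]
          simp
      _ ≤ _ := by gcongr
  rw [l2norm_sq]
  simp only [Real.norm_eq_abs, sq_abs]
  rw [key]
  refine mul_le_mul_of_nonneg_left hle ?_
  exact div_nonneg measureReal_nonneg (mul_nonneg (Nat.cast_nonneg _) measureReal_nonneg)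

end smooth

section sobolev

variable {T : Mesh d} {K γ : Finset (Euc d)} {v : H1 T.domain} {t : Euc d → ℝ}

lemma Mesh.memLp_hull {F : Type*} [NormedAddCommGroup F] (hK : K ∈ T.elements) {f : Euc d → F}
    (hf : MemLp f 2 (vol T.domain)) : MemLp f 2 (volume.restrict (hull K)) :=
  hf.mono_measure (T.restrict_hull_le_vol hK)

lemma Mesh.tendsto_hull {F : Type*} [NormedAddCommGroup F] (hK : K ∈ T.elements)
    {f : ℕ → Euc d → F} (h : Tendsto (fun n => eLpNorm (f n) 2 (vol T.domain)) atTop (𝓝 0)) :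
    Tendsto (fun n => eLpNorm (f n) 2 (volume.restrict (hull K))) atTop (𝓝 0) :=
  tendsto_of_tendsto_of_tendsto_of_le_of_le tendsto_const_nhds h (fun _ => zero_le)
    fun _ => eLpNorm_mono_measure _ (T.restrict_hull_le_vol hK)

lemma tendsto_integral_of_tendsto_eLpNorm {μ : Measure (Euc d)} [IsFiniteMeasure μ]
    {f : ℕ → Euc d → ℝ} {g : Euc d → ℝ} (hf : ∀ n, MemLp (f n) 2 μ) (hg : MemLp g 2 μ)
    (h : Tendsto (fun n => eLpNorm (f n - g) 2 μ) atTop (𝓝 0)) :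
    Tendsto (fun n => ∫ x, f n x ∂μ) atTop (𝓝 (∫ x, g x ∂μ)) := by
  have e : ∀ {f : Euc d → ℝ} (hf : MemLp f 2 μ),
      ∫ x, f x ∂μ = inner ℝ ((memLp_const (1 : ℝ)).toLp (fun _ => 1)) (hf.toLp f) := by
    intro f hf
    rw [L2.inner_def]
    refine integral_congr_ae ?_
    filter_upwards [hf.coeFn_toLp, (memLp_const (μ := μ) (p := 2) (1 : ℝ)).coeFn_toLp] with x h1 h2
    rw [h1, h2]; simp
  simp only [e (hf _), e hg]
  refine Tendsto.inner tendsto_const_nhds ?_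
  rw [Lp.tendsto_Lp_iff_tendsto_eLpNorm'']
  exact h

/-- The Poincaré inequality on an element, for functions in `H¹(Ω)`. -/
theorem IsTrace.poincare (hv : IsTrace T v t) (hK : K ∈ T.elements) :
    4 * (d + 1) * (l2norm (volume.restrict (hull K)) v.val ^ 2 -
      (∫ x in hull K, v.val x) ^ 2 / volume.real (hull K)) ≤
      Problem.h K ^ 2 * l2norm (volume.restrict (hull K)) v.grad ^ 2 := by
  obtain ⟨-, φ, hφ, h1, h2, -⟩ := hv
  have hc := isCompact_hull K
  have m1 : ∀ n, MemLp (φ n) 2 (volume.restrict (hull K)) := fun n =>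
    memLp_restrict_of_continuous (hφ n).continuous hc hc.measure_lt_top
  have m2 : ∀ n, MemLp (gradient (φ n)) 2 (volume.restrict (hull K)) := fun n =>
    memLp_restrict_of_continuous (continuous_gradient (hφ n)) hc hc.measure_lt_top
  have mv := T.memLp_hull hK v.memLp_val
  have t1 := tendsto_l2norm m1 mv (T.tendsto_hull hK h1)
  have t2 := tendsto_l2norm m2 (T.memLp_hull hK v.memLp_grad) (T.tendsto_hull hK h2)
  have t3 := tendsto_integral_of_tendsto_eLpNorm m1 mv (T.tendsto_hull hK h1)
  exact le_of_tendsto_of_tendsto' (((t1.pow 2).sub ((t3.pow 2).div_const _)).const_mul _)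
    ((t2.pow 2).const_mul _) fun n => smooth_poincare hK (hφ n)

/-- The trace inequality on an element, for functions in `H¹(Ω)`. -/
theorem IsTrace.trace_le (hv : IsTrace T v t) (hd : 1 ≤ d) (hK : K ∈ T.elements)
    (hγ : T.IsBoundaryFacet γ) (hγK : γ ⊆ K) (c : ℝ) :
    l2norm ((surf d).restrict (hull γ)) (fun x => t x - c) ^ 2 ≤ Problem.ratio K γ *
      (d * l2norm (volume.restrict (hull K)) (fun x => v.val x - c) ^ 2 +
        2 * Problem.h K * (l2norm (volume.restrict (hull K)) (fun x => v.val x - c) *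
          l2norm (volume.restrict (hull K)) v.grad)) := by
  obtain ⟨mt, φ, hφ, h1, h2, h3⟩ := hv
  have hc := isCompact_hull K
  have hγt := surf_hull_lt_top' hd hγ.1 hγ.affineIndependent
  have : IsFiniteMeasure ((surf d).restrict (hull γ)) := ⟨by simpa using hγt⟩
  have hle : (surf d).restrict (hull γ) ≤ (surf d).restrict T.bdry :=
    Measure.restrict_mono (Set.subset_biUnion_of_mem (u := fun γ => hull γ) hγ) le_rfl
  have hφc : ∀ n, ContDiff ℝ ∞ fun x => φ n x - c := fun n => (hφ n).sub contDiff_const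
  have esub : ∀ (n : ℕ) (w : Euc d → ℝ), ((fun x => φ n x - c) - fun x => w x - c) = φ n - w := by
    intro n w
    funext x
    simp
  have t1 := tendsto_l2norm (μ := volume.restrict (hull K)) (f := fun n x => φ n x - c)
    (g := fun x => v.val x - c)
    (fun n => memLp_restrict_of_continuous (hφc n).continuous hc hc.measure_lt_top)
    ((T.memLp_hull hK v.memLp_val).sub (memLp_const c))
    (by simpa only [esub] using T.tendsto_hull hK h1)
  have t2 := tendsto_l2norm (fun n => memLp_restrict_of_continuous
    (continuous_gradient (hφ n)) hc hc.measure_lt_top)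
    (T.memLp_hull hK v.memLp_grad) (T.tendsto_hull hK h2)
  have t3 := tendsto_l2norm (μ := (surf d).restrict (hull γ)) (f := fun n x => φ n x - c)
    (g := fun x => t x - c)
    (fun n => memLp_restrict_of_continuous (hφc n).continuous (isCompact_hull γ) hγt)
    ((mt.mono_measure hle).sub (memLp_const c)) (by
      simp only [esub]
      exact tendsto_of_tendsto_of_tendsto_of_le_of_le tendsto_const_nhds h3 (fun _ => zero_le)
        fun _ => eLpNorm_mono_measure _ hle)
  refine le_of_tendsto_of_tendsto' (t3.pow 2)
    ((((t1.pow 2).const_mul _).add ((t1.mul t2).const_mul _)).const_mul _) fun n => ?_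
  have := smooth_trace hd hK hγ.1 hγK (hφc n)
  rwa [gradient_sub_const] at this

end sobolev

/-! ### The error estimate -/

lemma l2norm_sub_mean_sq {K : Finset (Euc d)} (hK : 0 < volume.real (hull K)) {f : Euc d → ℝ}
    (hf : MemLp f 2 (volume.restrict (hull K))) :
    l2norm (volume.restrict (hull K)) (fun x => f x - (∫ x in hull K, f x) / volume.real (hull K)) ^ 2 =
      l2norm (volume.restrict (hull K)) f ^ 2 - (∫ x in hull K, f x) ^ 2 / volume.real (hull K) := by
  set c := (∫ x in hull K, f x) / volume.real (hull K) with hc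
  have hcv : c * volume.real (hull K) = ∫ x in hull K, f x := by
    rw [hc]; field_simp
  have i1 : Integrable f (volume.restrict (hull K)) := hf.integrable (by norm_num)
  have i2 : Integrable (fun x => f x ^ 2) (volume.restrict (hull K)) := hf.integrable_sq
  have i3 := (i1.const_mul (2 * c)).sub (integrable_const (c ^ 2))
  have e : ∀ x, (f x - c) ^ 2 = f x ^ 2 - (2 * c * f x - c ^ 2) := fun x => by ring
  rw [l2norm_sq, l2norm_sq]
  simp only [Real.norm_eq_abs, sq_abs, e]
  rw [integral_sub i2 (by exact i3),
    integral_sub (i1.const_mul (2 * c)) (integrable_const _), integral_const_mul, ← hcv]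
  simp
  field_simp
  ring

/-- The maximum of `D A² + 2 h A B` subject to `B² + κ² A² = 1` is at most
`κ⁻¹ ((2 h)² + (D / κ)²)^{1/2}`. -/
lemma quadratic_le {κ A B h D : ℝ} (hκ : 0 < κ) :
    D * A ^ 2 + 2 * h * (A * B) ≤
      1 / κ * Real.sqrt ((2 * h) ^ 2 + (D / κ) ^ 2) * (B ^ 2 + κ ^ 2 * A ^ 2) := by
  have h1 : D / κ * (κ * A) ^ 2 + 2 * h * (κ * A * B) ≤
      Real.sqrt ((2 * h) ^ 2 + (D / κ) ^ 2) * (B ^ 2 + κ ^ 2 * A ^ 2) := by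
    refine le_trans (Real.le_sqrt_of_sq_le (y := ((2 * h) ^ 2 + (D / κ) ^ 2) *
      (B ^ 2 + κ ^ 2 * A ^ 2) ^ 2) ?_) ?_
    · have : (D / κ * (κ * A) ^ 2 + 2 * h * (κ * A * B)) ^ 2 =
          (κ * A) ^ 2 * (((2 * h) ^ 2 + (D / κ) ^ 2) * (B ^ 2 + κ ^ 2 * A ^ 2) -
            (D / κ * B - 2 * h * (κ * A)) ^ 2) := by ring
      rw [this]
      have h2 : (κ * A) ^ 2 ≤ B ^ 2 + κ ^ 2 * A ^ 2 := by nlinarith [sq_nonneg B]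
      calc (κ * A) ^ 2 * (((2 * h) ^ 2 + (D / κ) ^ 2) * (B ^ 2 + κ ^ 2 * A ^ 2) -
            (D / κ * B - 2 * h * (κ * A)) ^ 2)
          ≤ (κ * A) ^ 2 * (((2 * h) ^ 2 + (D / κ) ^ 2) * (B ^ 2 + κ ^ 2 * A ^ 2)) := by
            gcongr
            linarith [sq_nonneg (D / κ * B - 2 * h * (κ * A))]
        _ ≤ (B ^ 2 + κ ^ 2 * A ^ 2) * (((2 * h) ^ 2 + (D / κ) ^ 2) * (B ^ 2 + κ ^ 2 * A ^ 2)) := by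
            gcongr
        _ = _ := by ring
    · rw [Real.sqrt_mul (by positivity), Real.sqrt_sq (by positivity)]
  have h2 : D * A ^ 2 + 2 * h * (A * B) =
      1 / κ * (D / κ * (κ * A) ^ 2 + 2 * h * (κ * A * B)) := by
    field_simp
  rw [h2, mul_assoc (1 / κ)]
  exact mul_le_mul_of_nonneg_left h1 (by positivity)

lemma mul_add_mul_le_sqrt {a b A B κ : ℝ} (hκ : 0 < κ) :
    a * B + b * A ≤ Real.sqrt (a ^ 2 + κ⁻¹ ^ 2 * b ^ 2) * Real.sqrt (B ^ 2 + κ ^ 2 * A ^ 2) := by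
  rw [← Real.sqrt_mul (by positivity)]
  refine Real.le_sqrt_of_sq_le ?_
  have : b * A = (κ⁻¹ * b) * (κ * A) := by field_simp
  rw [this]
  nlinarith [sq_nonneg (a * (κ * A) - (κ⁻¹ * b) * B)]

namespace Problem

variable {P : Problem d} {K γ : Finset (Euc d)}

lemma kappa_ae_eq (hK : K ∈ P.mesh.elements) :
    ∀ᵐ x ∂(volume.restrict (hull K)), P.kappa x = P.kappaK K := by
  rw [hull, ← restrict_interior_convex (convex_convexHull ℝ _), ← hull]
  exact ae_restrict_of_forall_mem isOpen_interior.measurableSet fun x hx => P.kappa_eq K hK x hx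

/-- The energy norm on the element `K`. -/
def localEnergy (P : Problem d) (K : Finset (Euc d)) (e : P.V) : ℝ :=
  Real.sqrt (l2norm (volume.restrict (hull K)) e.grad ^ 2 +
    P.kappaK K ^ 2 * l2norm (volume.restrict (hull K)) e.val ^ 2)

lemma localEnergy_nonneg (e : P.V) : 0 ≤ P.localEnergy K e := Real.sqrt_nonneg _

lemma localEnergy_sq (e : P.V) : P.localEnergy K e ^ 2 =
    l2norm (volume.restrict (hull K)) e.grad ^ 2 +
    P.kappaK K ^ 2 * l2norm (volume.restrict (hull K)) e.val ^ 2 :=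
  Real.sq_sqrt (by positivity)

lemma l2norm_grad_le (e : P.V) :
    l2norm (volume.restrict (hull K)) e.grad ≤ P.localEnergy K e :=
  Real.le_sqrt_of_sq_le (by nlinarith [sq_nonneg (P.kappaK K * l2norm (volume.restrict (hull K)) e.val)])

lemma h_nonneg (K : Finset (Euc d)) : 0 ≤ h K := Metric.diam_nonneg

lemma minh_nonneg (hK : K ∈ P.mesh.elements) : 0 ≤ P.minh K := by
  have := P.kappaK_nonneg K hK
  have := h_nonneg K
  unfold minh
  split_ifs <;> positivity

lemma ratio_nonneg (K γ : Finset (Euc d)) : 0 ≤ ratio K γ := by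
  unfold ratio; positivity

/-- The mean value on the element `K`. -/
def mean (K : Finset (Euc d)) (f : Euc d → ℝ) : ℝ := (∫ x in hull K, f x) / volume.real (hull K)

/-- The distance of `e` to the constants is at most `m_K` times the energy norm. -/
lemma l2norm_sub_mean_le (hd : 2 ≤ d) (hK : K ∈ P.mesh.elements) (e : P.V) :
    l2norm (volume.restrict (hull K)) (fun x => e.val x - mean K e.val) ≤
      P.minh K * P.localEnergy K e := by
  have hv := P.mesh.volume_real_hull_pos hK
  have hsq := l2norm_sub_mean_sq hv (P.mesh.memLp_hull hK e.memLp_val)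
  have hp := e.isTrace.poincare hK
  change l2norm (volume.restrict (hull K)) (fun x => e.val x - mean K e.val) ^ 2 = _ at hsq
  rw [← hsq] at hp
  set A₀ := l2norm (volume.restrict (hull K)) (fun x => e.val x - mean K e.val)
  set A := l2norm (volume.restrict (hull K)) e.val
  set B := l2norm (volume.restrict (hull K)) e.grad with hB
  have hA₀ : 0 ≤ A₀ := l2norm_nonneg _ _
  have hA : 0 ≤ A := l2norm_nonneg _ _
  have hBn : 0 ≤ B := l2norm_nonneg _ _
  have hh := h_nonneg K
  have hN := P.localEnergy_nonneg (K := K) e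
  have hBN : B ≤ P.localEnergy K e := P.l2norm_grad_le e
  have h1 : A₀ ≤ h K / Real.pi * P.localEnergy K e := by
    have hpi := Real.pi_pos
    -- `π² < 12 ≤ 4 (d + 1)`
    have hpi2 : Real.pi ^ 2 ≤ 4 * (d + 1) := by
      have h3 := Real.pi_lt_d2
      have h4 : (2 : ℝ) ≤ d := by exact_mod_cast hd
      nlinarith
    have h2 : A₀ ≤ h K / Real.pi * B := by
      refine le_of_sq_le_sq ?_ (by positivity)
      rw [mul_pow, div_pow, div_mul_eq_mul_div, le_div_iff₀ (by positivity)]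
      nlinarith [mul_le_mul_of_nonneg_right hpi2 (sq_nonneg A₀)]
    exact h2.trans (by gcongr)
  unfold minh
  split_ifs with h0
  · exact h1
  · have hκ : 0 < P.kappaK K := lt_of_le_of_ne (P.kappaK_nonneg K hK) (Ne.symm h0)
    rw [min_mul_of_nonneg _ _ hN]
    refine le_min h1 ?_
    have h2 : A₀ ≤ A := by
      refine le_of_sq_le_sq ?_ hA
      rw [hsq]
      have : 0 ≤ (∫ x in hull K, e.val x) ^ 2 / volume.real (hull K) := by positivity
      linarith
    have h3 : P.kappaK K * A ≤ P.localEnergy K e :=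
      Real.le_sqrt_of_sq_le (by nlinarith [sq_nonneg B])
    rw [one_div_mul_eq_div, le_div_iff₀ hκ, mul_comm]
    exact (mul_le_mul_of_nonneg_left h2 hκ.le).trans h3

lemma mem_neumannOf : γ ∈ P.neumannOf K ↔ γ ∈ P.neumann ∧ γ ⊆ K := by
  unfold neumannOf
  exact Finset.mem_filter

/-- The trace inequality with the constant `C_T`. -/
lemma l2norm_trace_le (hd : 2 ≤ d) (hK : K ∈ P.mesh.elements) (hγ : γ ∈ P.neumannOf K)
    (hκ : 0 < P.kappaK K) (e : P.V) :
    l2norm ((surf d).restrict (hull γ)) e.trace ≤ P.CT K γ * P.localEnergy K e := by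
  obtain ⟨hγN, hγK⟩ := mem_neumannOf.1 hγ
  have ht := e.isTrace.trace_le (by omega) hK (P.neumann_bdry γ hγN) hγK 0
  simp only [sub_zero] at ht
  have hr := ratio_nonneg K γ
  refine le_of_sq_le_sq (ht.trans ?_) (mul_nonneg (Real.sqrt_nonneg _) (Real.sqrt_nonneg _))
  rw [mul_pow, CT, Real.sq_sqrt (by positivity), localEnergy_sq, mul_assoc (ratio K γ),
    mul_assoc (ratio K γ)]
  refine mul_le_mul_of_nonneg_left ?_ hr
  exact quadratic_le hκ

/-- The trace inequality with the constant `\overline{C}_T`, for `e` minus its mean value on the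
element. -/
lemma l2norm_trace_sub_mean_le (hd : 2 ≤ d) (hK : K ∈ P.mesh.elements) (hγ : γ ∈ P.neumannOf K)
    (e : P.V) :
    l2norm ((surf d).restrict (hull γ)) (fun x => e.trace x - mean K e.val) ≤
      P.CTbar K γ * P.localEnergy K e := by
  obtain ⟨hγN, hγK⟩ := mem_neumannOf.1 hγ
  have ht := e.isTrace.trace_le (by omega) hK (P.neumann_bdry γ hγN) hγK (mean K e.val)
  have hr := ratio_nonneg K γ
  have hm := minh_nonneg hK
  have hh := h_nonneg K
  have hN := P.localEnergy_nonneg (K := K) e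
  have hA := l2norm_sub_mean_le hd hK e
  have hA0 := l2norm_nonneg (volume.restrict (hull K)) (fun x => e.val x - mean K e.val)
  have hB := P.l2norm_grad_le (K := K) e
  have hB0 := l2norm_nonneg (volume.restrict (hull K)) e.grad
  refine le_of_sq_le_sq (ht.trans ?_) (mul_nonneg (Real.sqrt_nonneg _) (Real.sqrt_nonneg _))
  rw [mul_pow, CTbar, Real.sq_sqrt (by positivity), mul_assoc (ratio K γ), mul_assoc (ratio K γ)]
  refine mul_le_mul_of_nonneg_left ?_ hr
  calc _ ≤ d * (P.minh K * P.localEnergy K e) ^ 2 +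
        2 * h K * (P.minh K * P.localEnergy K e * P.localEnergy K e) := by gcongr
    _ = _ := by ring

section memLp

lemma hull_subset_ΓN (hγ : γ ∈ P.neumann) : hull γ ⊆ P.ΓN :=
  Set.subset_biUnion_of_mem (u := fun γ => hull γ) hγ

lemma memLp_facet (hγ : γ ∈ P.neumann) {g : Euc d → ℝ} (hg : MemLp g 2 ((surf d).restrict P.ΓN)) :
    MemLp g 2 ((surf d).restrict (hull γ)) :=
  hg.mono_measure (Measure.restrict_mono (hull_subset_ΓN hγ) le_rfl)

lemma memLp_trace (hγ : γ ∈ P.neumann) (e : P.V) :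
    MemLp e.trace 2 ((surf d).restrict (hull γ)) :=
  e.isTrace.1.mono_measure (Measure.restrict_mono
    (Set.subset_biUnion_of_mem (u := fun γ => hull γ) (P.neumann_bdry γ hγ)) le_rfl)

lemma isFiniteMeasure_facet (hd : 1 ≤ d) (hγ : γ ∈ P.neumann) :
    IsFiniteMeasure ((surf d).restrict (hull γ)) :=
  ⟨by simpa using surf_hull_lt_top' hd (P.neumann_bdry γ hγ).1 (P.neumann_bdry γ hγ).affineIndependent⟩

lemma memLp_projg (hγ : γ ∈ P.neumann) : MemLp (P.projg γ) 2 ((surf d).restrict (hull γ)) :=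
  memLp_affineProj (memLp_facet hγ P.memLp_gN)

lemma memLp_projf (hK : K ∈ P.mesh.elements) : MemLp (P.projf K) 2 (volume.restrict (hull K)) :=
  memLp_affineProj (P.mesh.memLp_hull hK P.memLp_f)

lemma memLp_kappa_sq_mul (hK : K ∈ P.mesh.elements) {g : Euc d → ℝ}
    (hg : MemLp g 2 (vol P.Ω)) :
    MemLp (fun x => P.kappa x ^ 2 * g x) 2 (volume.restrict (hull K)) := by
  refine ((P.mesh.memLp_hull hK hg).const_mul (P.kappaK K ^ 2)).ae_eq ?_
  filter_upwards [kappa_ae_eq hK] with x hx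
  rw [hx]

lemma memLp_residual (hK : K ∈ P.mesh.elements) (uh : P.V) (τ : Hdiv P.mesh.domain) :
    MemLp (P.residual uh τ K) 2 (volume.restrict (hull K)) :=
  ((memLp_projf hK).sub (memLp_kappa_sq_mul hK uh.memLp_val)).add
    (P.mesh.memLp_hull hK τ.memLp_div)

lemma memLp_eps (hK : K ∈ P.mesh.elements) (uh : P.V) (τ : Hdiv P.mesh.domain) :
    MemLp (P.eps uh τ) 2 (volume.restrict (hull K)) :=
  P.mesh.memLp_hull hK (τ.memLp_val.sub uh.memLp_grad)

end memLp

/-- Oscillation on a facet: `g_N - Π_γ g_N` is orthogonal to the constants, so that `e` can be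
replaced by `e` minus its mean value on the element. -/
lemma integral_osc_facet_le (hd : 2 ≤ d) (hK : K ∈ P.mesh.elements) (hγ : γ ∈ P.neumannOf K)
    (e : P.V) :
    ∫ x in hull γ, (P.gN x - P.projg γ x) * e.trace x ∂(surf d) ≤
      P.minCT K γ * l2norm ((surf d).restrict (hull γ)) (fun x => P.gN x - P.projg γ x) *
        P.localEnergy K e := by
  obtain ⟨hγN, hγK⟩ := mem_neumannOf.1 hγ
  have : IsFiniteMeasure ((surf d).restrict (hull γ)) := isFiniteMeasure_facet (by omega) hγN
  have mg := memLp_facet hγN P.memLp_gN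
  have mdiff : MemLp (fun x => P.gN x - P.projg γ x) 2 ((surf d).restrict (hull γ)) :=
    mg.sub (memLp_projg hγN)
  have mt := memLp_trace hγN e
  set O := l2norm ((surf d).restrict (hull γ)) (fun x => P.gN x - P.projg γ x) with hO
  have hO0 : 0 ≤ O := l2norm_nonneg _ _
  have hbar : ∫ x in hull γ, (P.gN x - P.projg γ x) * e.trace x ∂(surf d) ≤
      P.CTbar K γ * O * P.localEnergy K e := by
    have h0 := integral_sub_affineProj mg
    have e1 : ∫ x in hull γ, (P.gN x - P.projg γ x) * e.trace x ∂(surf d) =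
        ∫ x in hull γ, (P.gN x - P.projg γ x) * (e.trace x - mean K e.val) ∂(surf d) := by
      simp only [mul_sub]
      rw [integral_sub (integrable_mul mdiff mt) (integrable_mul mdiff (memLp_const _)),
        integral_mul_const]
      have : ∫ x in hull γ, (P.gN x - P.projg γ x) ∂(surf d) = 0 := h0
      rw [this, zero_mul, sub_zero]
    rw [e1]
    refine (integral_mul_le mdiff (mt.sub (memLp_const _))).trans ?_
    calc _ ≤ O * (P.CTbar K γ * P.localEnergy K e) :=
          mul_le_mul_of_nonneg_left (l2norm_trace_sub_mean_le hd hK hγ e) hO0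
      _ = _ := by ring
  unfold minCT
  split_ifs with h0
  · exact hbar
  · have hκ : 0 < P.kappaK K := lt_of_le_of_ne (P.kappaK_nonneg K hK) (Ne.symm h0)
    rw [mul_assoc, min_mul_of_nonneg _ _ (mul_nonneg hO0 (P.localEnergy_nonneg e)), ← mul_assoc,
      ← mul_assoc]
    refine le_min ?_ hbar
    refine (integral_mul_le mdiff mt).trans ?_
    calc _ ≤ O * (P.CT K γ * P.localEnergy K e) :=
          mul_le_mul_of_nonneg_left (l2norm_trace_le hd hK hγ hκ e) hO0
      _ = _ := by ring

/-- Oscillation on an element: `f - Π_K f` is orthogonal to the constants, so that `e` can be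
replaced by `e` minus its mean value. -/
lemma integral_osc_element_le (hd : 2 ≤ d) (hK : K ∈ P.mesh.elements) (e : P.V) :
    ∫ x in hull K, (P.f x - P.projf K x) * e.val x ≤
      P.minh K * l2norm (volume.restrict (hull K)) (fun x => P.f x - P.projf K x) *
        P.localEnergy K e := by
  have mf := P.mesh.memLp_hull hK P.memLp_f
  have mdiff : MemLp (fun x => P.f x - P.projf K x) 2 (volume.restrict (hull K)) :=
    mf.sub (memLp_projf hK)
  have me := P.mesh.memLp_hull hK e.memLp_val
  have h0 : ∫ x in hull K, (P.f x - P.projf K x) = 0 := integral_sub_affineProj mf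
  have e1 : ∫ x in hull K, (P.f x - P.projf K x) * e.val x =
      ∫ x in hull K, (P.f x - P.projf K x) * (e.val x - mean K e.val) := by
    simp only [mul_sub]
    rw [integral_sub (integrable_mul mdiff me) (integrable_mul mdiff (memLp_const _)),
      integral_mul_const, h0, zero_mul, sub_zero]
  rw [e1]
  refine (integral_mul_le mdiff (me.sub (memLp_const _))).trans ?_
  calc _ ≤ l2norm (volume.restrict (hull K)) (fun x => P.f x - P.projf K x) *
        (P.minh K * P.localEnergy K e) :=
        mul_le_mul_of_nonneg_left (l2norm_sub_mean_le hd hK e) (l2norm_nonneg _ _)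
    _ = _ := by ring

variable {uh : P.V} {τ : Hdiv P.mesh.domain} {τν : Euc d → ℝ}

/-- The part of the error equation on one element which does not involve data oscillation. -/
lemma residual_terms_le (hd : 2 ≤ d) (hK : K ∈ P.mesh.elements)
    (hτν : MemLp τν 2 ((surf d).restrict P.ΓN)) (hτ : P.Equilibrated uh τ τν) (e : P.V) :
    (∫ x in hull K, inner ℝ (P.eps uh τ x) (e.grad x)) +
      (∫ x in hull K, P.residual uh τ K x * e.val x) +
      ∑ γ ∈ P.neumannOf K, ∫ x in hull γ, P.residualN τν γ x * e.trace x ∂(surf d) ≤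
      P.etaK uh τ τν K * P.localEnergy K e := by
  have meps := memLp_eps hK uh τ
  have mres := memLp_residual hK uh τ
  have mval := P.mesh.memLp_hull hK e.memLp_val
  have mgrad := P.mesh.memLp_hull hK e.memLp_grad
  have h1 := integral_inner_le meps mgrad
  unfold etaK
  split_ifs with h0
  -- if `κ_K = 0`, then the residuals vanish by equilibration
  · obtain ⟨hdiv, hfac⟩ := hτ K hK h0
    have r0 : ∫ x in hull K, P.residual uh τ K x * e.val x = 0 := by
      refine integral_eq_zero_of_ae ?_
      filter_upwards [hdiv] with x hx
      have : P.residual uh τ K x = 0 := by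
        rw [residual, ← hx]; ring
      simp [this]
    have rN0 : ∑ γ ∈ P.neumannOf K, ∫ x in hull γ, P.residualN τν γ x * e.trace x ∂(surf d) = 0 := by
      refine Finset.sum_eq_zero fun γ hγ => integral_eq_zero_of_ae ?_
      obtain ⟨hγN, hγK⟩ := mem_neumannOf.1 hγ
      filter_upwards [hfac γ hγN hγK] with x hx
      simp [residualN, hx]
    rw [r0, rN0, add_zero, add_zero]
    exact h1.trans (mul_le_mul_of_nonneg_left (P.l2norm_grad_le e) (l2norm_nonneg _ _))
  · have hκ : 0 < P.kappaK K := lt_of_le_of_ne (P.kappaK_nonneg K hK) (Ne.symm h0)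
    rw [add_mul, Finset.sum_mul]
    refine add_le_add ?_ (Finset.sum_le_sum fun γ hγ => ?_)
    · exact (add_le_add h1 (integral_mul_le mres mval)).trans (mul_add_mul_le_sqrt hκ)
    · obtain ⟨hγN, hγK⟩ := mem_neumannOf.1 hγ
      have mR : MemLp (P.residualN τν γ) 2 ((surf d).restrict (hull γ)) :=
        (memLp_projg hγN).sub (memLp_facet hγN hτν)
      refine (integral_mul_le mR (memLp_trace hγN e)).trans ?_
      calc _ ≤ l2norm ((surf d).restrict (hull γ)) (P.residualN τν γ) *
            (P.CT K γ * P.localEnergy K e) :=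
            mul_le_mul_of_nonneg_left (l2norm_trace_le hd hK hγ hκ e) (l2norm_nonneg _ _)
        _ = _ := by ring

section splitting

lemma integrable_bilin (hK : K ∈ P.mesh.elements) (u v : P.V) :
    IntegrableOn (fun x => inner ℝ (u.grad x) (v.grad x) + P.kappa x ^ 2 * u.val x * v.val x)
      (hull K) :=
  (integrable_inner (P.mesh.memLp_hull hK u.memLp_grad) (P.mesh.memLp_hull hK v.memLp_grad)).add
    (integrable_mul (memLp_kappa_sq_mul hK u.memLp_val) (P.mesh.memLp_hull hK v.memLp_val))

lemma bilin_eq_sum (u v : P.V) : P.bilin u v = ∑ K ∈ P.mesh.elements,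
    ∫ x in hull K, (inner ℝ (u.grad x) (v.grad x) + P.kappa x ^ 2 * u.val x * v.val x) :=
  P.mesh.integral_vol_domain fun _ hK => integrable_bilin hK u v

lemma bilin_self (e : P.V) : P.bilin e e = ∑ K ∈ P.mesh.elements, P.localEnergy K e ^ 2 := by
  rw [bilin_eq_sum]
  refine Finset.sum_congr rfl fun K hK => ?_
  have mval := P.mesh.memLp_hull hK e.memLp_val
  rw [localEnergy_sq, l2norm_sq, l2norm_sq, ← integral_const_mul, ← integral_add]
  · refine integral_congr_ae ?_
    filter_upwards [kappa_ae_eq hK] with x hx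
    rw [real_inner_self_eq_norm_sq, hx, Real.norm_eq_abs, sq_abs]
    ring
  · exact (P.mesh.memLp_hull hK e.memLp_grad).integrable_norm_pow (by norm_num)
  · exact (mval.integrable_norm_pow (by norm_num)).const_mul _

/-- The error equation, split into the contributions of the elements. -/
lemma bilin_error_eq (hd : 2 ≤ d) {u : P.V} (hu : P.IsWeakSolution u)
    (hν : P.IsNormalTrace τ τν) (e : P.V) :
    P.bilin u e - P.bilin uh e = ∑ K ∈ P.mesh.elements,
      (((∫ x in hull K, inner ℝ (P.eps uh τ x) (e.grad x)) +
        (∫ x in hull K, P.residual uh τ K x * e.val x) +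
        ∑ γ ∈ P.neumannOf K, ∫ x in hull γ, P.residualN τν γ x * e.trace x ∂(surf d)) +
      ((∫ x in hull K, (P.f x - P.projf K x) * e.val x) +
        ∑ γ ∈ P.neumannOf K, ∫ x in hull γ, (P.gN x - P.projg γ x) * e.trace x ∂(surf d))) := by
  have hτν := hν.1
  have ig : ∀ γ ∈ P.neumann, Integrable (fun x => P.gN x * e.trace x)
      ((surf d).restrict (hull γ)) := fun γ hγ =>
    integrable_mul (memLp_facet hγ P.memLp_gN) (memLp_trace hγ e)
  have iτ : ∀ γ ∈ P.neumann, Integrable (fun x => τν x * e.trace x)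
      ((surf d).restrict (hull γ)) := fun γ hγ =>
    integrable_mul (memLp_facet hγ hτν) (memLp_trace hγ e)
  have iF : ∀ K ∈ P.mesh.elements, Integrable (fun x => P.f x * e.val x)
      (volume.restrict (hull K)) := fun K hK =>
    integrable_mul (P.mesh.memLp_hull hK P.memLp_f) (P.mesh.memLp_hull hK e.memLp_val)
  have iT : ∀ K ∈ P.mesh.elements, Integrable
      (fun x => inner ℝ (τ.val x) (e.grad x) + τ.div x * e.val x)
      (volume.restrict (hull K)) := fun K hK =>
    (integrable_inner (P.mesh.memLp_hull hK τ.memLp_val) (P.mesh.memLp_hull hK e.memLp_grad)).add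
      (integrable_mul (P.mesh.memLp_hull hK τ.memLp_div) (P.mesh.memLp_hull hK e.memLp_val))
  have h1 := hν.2 e
  have hT : ∫ x, (inner ℝ (τ.val x) (e.grad x) + τ.div x * e.val x) ∂(vol P.Ω) =
      ∑ K ∈ P.mesh.elements, ∫ x in hull K, (inner ℝ (τ.val x) (e.grad x) + τ.div x * e.val x) :=
    P.mesh.integral_vol_domain iT
  have hF : ∫ x, P.f x * e.val x ∂(vol P.Ω) =
      ∑ K ∈ P.mesh.elements, ∫ x in hull K, P.f x * e.val x := P.mesh.integral_vol_domain iF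
  rw [hT, integral_ΓN (by omega) iτ, sum_neumannOf] at h1
  rw [hu e, lin, hF, integral_ΓN (by omega) ig, sum_neumannOf, bilin_eq_sum]
  have hsum : ∀ K ∈ P.mesh.elements,
      (((∫ x in hull K, inner ℝ (P.eps uh τ x) (e.grad x)) +
        (∫ x in hull K, P.residual uh τ K x * e.val x) +
        ∑ γ ∈ P.neumannOf K, ∫ x in hull γ, P.residualN τν γ x * e.trace x ∂(surf d)) +
      ((∫ x in hull K, (P.f x - P.projf K x) * e.val x) +
        ∑ γ ∈ P.neumannOf K, ∫ x in hull γ, (P.gN x - P.projg γ x) * e.trace x ∂(surf d))) =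
      (∫ x in hull K, P.f x * e.val x) +
      (∫ x in hull K, (inner ℝ (τ.val x) (e.grad x) + τ.div x * e.val x)) -
      (∫ x in hull K, (inner ℝ (uh.grad x) (e.grad x) + P.kappa x ^ 2 * uh.val x * e.val x)) +
      (∑ γ ∈ P.neumannOf K, ∫ x in hull γ, P.gN x * e.trace x ∂(surf d)) -
      (∑ γ ∈ P.neumannOf K, ∫ x in hull γ, τν x * e.trace x ∂(surf d)) := by
    intro K hK
    have me := P.mesh.memLp_hull hK e.memLp_val
    have mf := P.mesh.memLp_hull hK P.memLp_f
    have i1 := integrable_inner (memLp_eps hK uh τ) (P.mesh.memLp_hull hK e.memLp_grad)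
    have i2 := integrable_mul (memLp_residual hK uh τ) me
    have i3 : Integrable (fun x => (P.f x - P.projf K x) * e.val x) (volume.restrict (hull K)) :=
      integrable_mul (mf.sub (memLp_projf hK)) me
    have vol_part : (∫ x in hull K, inner ℝ (P.eps uh τ x) (e.grad x)) +
        (∫ x in hull K, P.residual uh τ K x * e.val x) +
        ∫ x in hull K, (P.f x - P.projf K x) * e.val x =
        (∫ x in hull K, P.f x * e.val x) +
        (∫ x in hull K, (inner ℝ (τ.val x) (e.grad x) + τ.div x * e.val x)) -
        ∫ x in hull K, (inner ℝ (uh.grad x) (e.grad x) + P.kappa x ^ 2 * uh.val x * e.val x) := by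
      rw [← integral_add i1 i2, ← integral_add (by exact i1.add i2) i3,
        ← integral_add (iF K hK) (iT K hK),
        ← integral_sub (by exact (iF K hK).add (iT K hK)) (integrable_bilin hK uh e)]
      refine integral_congr_ae (ae_of_all _ fun x => ?_)
      simp only [eps, residual, inner_sub_left]
      ring
    have facet_part : ∑ γ ∈ P.neumannOf K, ∫ x in hull γ, P.residualN τν γ x * e.trace x ∂(surf d) +
        ∑ γ ∈ P.neumannOf K, ∫ x in hull γ, (P.gN x - P.projg γ x) * e.trace x ∂(surf d) =
        (∑ γ ∈ P.neumannOf K, ∫ x in hull γ, P.gN x * e.trace x ∂(surf d)) -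
        ∑ γ ∈ P.neumannOf K, ∫ x in hull γ, τν x * e.trace x ∂(surf d) := by
      rw [← Finset.sum_add_distrib, ← Finset.sum_sub_distrib]
      refine Finset.sum_congr rfl fun γ hγ => ?_
      obtain ⟨hγN, -⟩ := mem_neumannOf.1 hγ
      have mt := memLp_trace hγN e
      have j1 : Integrable (fun x => P.residualN τν γ x * e.trace x)
          ((surf d).restrict (hull γ)) :=
        integrable_mul ((memLp_projg hγN).sub (memLp_facet hγN hτν)) mt
      have j2 : Integrable (fun x => (P.gN x - P.projg γ x) * e.trace x)
          ((surf d).restrict (hull γ)) :=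
        integrable_mul ((memLp_facet hγN P.memLp_gN).sub (memLp_projg hγN)) mt
      rw [← integral_add j1 j2, ← integral_sub (ig γ hγN) (iτ γ hγN)]
      refine integral_congr_ae (ae_of_all _ fun x => ?_)
      simp only [residualN]
      ring
    linear_combination vol_part + facet_part
  rw [Finset.sum_congr rfl hsum]
  simp only [Finset.sum_add_distrib, Finset.sum_sub_distrib]
  linear_combination -h1

lemma bilin_sub_left (u v e : P.V) : P.bilin (u - v) e = P.bilin u e - P.bilin v e := by
  rw [bilin_eq_sum, bilin_eq_sum, bilin_eq_sum, ← Finset.sum_sub_distrib]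
  refine Finset.sum_congr rfl fun K hK => ?_
  rw [← integral_sub (integrable_bilin hK u e) (integrable_bilin hK v e)]
  refine integral_congr_ae (ae_of_all _ fun x => ?_)
  have h1 : (u - v).grad x = u.grad x - v.grad x := rfl
  have h2 : (u - v).val x = u.val x - v.val x := rfl
  simp only [h1, h2, inner_sub_left]
  ring

end splitting

end Problem

end ReactionDiffusion
end

open ReactionDiffusion in
theorem theorem3p1 {d : ℕ} (hd : 2 ≤ d) (P : Problem d) (u : P.V) (hu : P.IsWeakSolution u)
    (uh : P.V) (τ : Hdiv P.mesh.domain) (τν : EuclideanSpace ℝ (Fin d) → ℝ)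
    (hν : P.IsNormalTrace τ τν) (hτ : P.Equilibrated uh τ τν) :
    P.energyNorm (u - uh) ≤ P.eta uh τ τν := by
  set e := u - uh with he
  have hE0 : 0 ≤ ∑ K ∈ P.mesh.elements, P.localEnergy K e ^ 2 :=
    Finset.sum_nonneg fun K _ => sq_nonneg _
  have hE : P.energyNorm e = Real.sqrt (∑ K ∈ P.mesh.elements, P.localEnergy K e ^ 2) := by
    rw [Problem.energyNorm, Problem.bilin_self]
  have hle : ∑ K ∈ P.mesh.elements, P.localEnergy K e ^ 2 ≤
      ∑ K ∈ P.mesh.elements, (P.etaK uh τ τν K + P.osc K) * P.localEnergy K e := by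
    rw [← Problem.bilin_self]
    nth_rw 1 [he]
    rw [Problem.bilin_sub_left, Problem.bilin_error_eq hd hu hν e]
    refine Finset.sum_le_sum fun K hK => ?_
    rw [add_mul, Problem.osc, add_mul, Finset.sum_mul]
    exact add_le_add (Problem.residual_terms_le hd hK hν.1 hτ e)
      (add_le_add (Problem.integral_osc_element_le hd hK e)
        (Finset.sum_le_sum fun γ hγ => Problem.integral_osc_facet_le hd hK hγ e))
  have hcs := Real.sum_mul_le_sqrt_mul_sqrt P.mesh.elements
    (fun K => P.etaK uh τ τν K + P.osc K) fun K => P.localEnergy K e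
  rw [hE, Problem.eta]
  have hs := hle.trans hcs
  rw [← Real.mul_self_sqrt hE0] at hs
  rcases (Real.sqrt_nonneg (∑ K ∈ P.mesh.elements, P.localEnergy K e ^ 2)).eq_or_lt with h0 | h0
  · rw [← h0]
    exact Real.sqrt_nonneg _
  · refine le_of_mul_le_mul_right ?_ h0
    simpa only [Real.mul_self_sqrt hE0] using hs
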